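/- Let $\mathbb K$ be an algebraically closed field of characteristic zero and let $n\ge 2$. Let $W_m$ be the space of symmetric $(m+1)\times(m+1)$ matrices over $\mathbb K$, identified with its dual $W_m^*$ by the trace form $\langle S,Y\rangle=\operatorname{tr}(SY)$, and let $\nu_2(\mathbb P^m)=\{[vv^t] : 0\ne v\in\mathbb K^{m+1}\}$ be the quadratic Veronese variety. Let $S_r\subset\mathbb P(W_n)=\mathbb P^{(n^2+3n)/2}$ be the locus of symmetric $(n+1)\times(n+1)$ matrices of rank at most $r$, so that $S_n=V(\det)$. For a reduced hypersurface $X=V(f)\subset\mathbb P^N$, let $\nabla_f:\mathbb P^N\dashrightarrow(\mathbb P^N)^*$ be its polar map $x\mapsto(\partial f/\partial x_0(x):\cdots:\partial f/\partial x_N(x))$, let $Z_X=\overline{\nabla_f(\mathbb P^N)}$ be its polar image, and let $X^*=\overline{\nabla_f(X)}\subseteq Z_X$ be its dual variety; $X$ has vanishing hessian if $\det(\partial^2f/\partial x_i\partial x_j)=0$ identically. The dual of an arbitrary irreducible projective variety $Y$ is the closure of the set of hyperplanes containing the tangent space of $Y$ at some smooth point. Let $p\in\nu_2(\mathbb P^n)\subset\mathbb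 P(W_n^*)$, let $p^\perp=\mathbb P^{(n^2+3n-2)/2}\subset\mathbb P(W_n)$ be the corresponding hyperplane, and let $Q_n=S_n\cap p^\perp\subset p^\perp$. Let $V_n\subset\mathbb P^{(n^2+3n-2)/2}=(p^\perp)^*$ be the projection of $\nu_2(\mathbb P^n)$ from $p$, that is, the closure of the image of $\nu_2(\mathbb P^n)\setminus\{p\}$. Then there is a point $q\in S_n\setminus S_{n-1}$ with tangent hyperplane $T_qS_n=p^\perp$, and: (i) $Q_n\subset\mathbb P^{(n^2+3n-2)/2}$ is an irreducible hypersurface of degree $n+1$, whose equation is the restriction of $\det$ to $p^\perp$; it has vanishing hessian, and $Q_n^*=V_n$. (ii) $Z_{Q_n}\subset(\mathbb P^{(n^2+3n-2)/2})^*$ is a hypersurface of degree $n$, which is a cone with vertex a $\mathbb P^{n-1}$ over a variety projectively equivalent to the dual of the Veronese variety $\nu_2(\mathbb P^{n-1})\subset\mathbb P^{(n^2+n-2)/2}$. (iii) $\operatorname{codim}(Q_n^*,Z_{Q_n})=\dim Z_{Q_n}-\dim Q_n^*=\dfrac{n^2+n-4}{2}$. -/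

import Mathlib

open scoped LinearAlgebra.Projectivization

noncomputable section

namespace PolarGeometry

variable {K : Type*} [Field K] {ι κ : Type*}

/-! ### Projective sets in `ℙ K (ι → K)`

The homogeneous coordinates are indexed by `ι`. The dual projective space is again `ℙ K (ι → K)`,
with the dual coordinates: `[y]` is the hyperplane `∑ i, y i * x i = 0`. -/

/-- The affine cone over a set of points of projective space, without its apex. -/
def affineCone (X : Set (ℙ K (ι → K))) : Set (ι → K) :=
  {x | ∃ h : x ≠ 0, Projectivization.mk K x h ∈ X}

/-- The homogeneous ideal `I(X)` of a set of points of projective space (over an infinite field, a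
polynomial vanishes on the cone if and only if all its homogeneous components do). -/
def homIdeal (X : Set (ℙ K (ι → K))) : Ideal (MvPolynomial ι K) :=
  MvPolynomial.vanishingIdeal K (affineCone X)

/-- The Zariski closure of a set of points of projective space. -/
def zariskiClosure (X : Set (ℙ K (ι → K))) : Set (ℙ K (ι → K)) :=
  {x | x.rep ∈ MvPolynomial.zeroLocus K (homIdeal X)}

/-- The points of projective space with a representative in a set of vectors
(zero vectors are ignored). -/
def points (A : Set (ι → K)) : Set (ℙ K (ι → K)) :=
  {x | ∃ v ∈ A, ∃ h : v ≠ 0, x = Projectivization.mk K v h}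

/-- `X` has dimension `d` as a projective set: its homogeneous coordinate ring has Krull
dimension `d + 1`. -/
def HasProjDim (X : Set (ℙ K (ι → K))) (d : ℕ) : Prop :=
  ringKrullDim (MvPolynomial ι K ⧸ homIdeal X) = ((d + 1 : ℕ) : WithBot ℕ∞)

/-- `Y` is contained in `X` and `dim X - dim Y = c`. -/
def HasCodim (Y X : Set (ℙ K (ι → K))) (c : ℕ) : Prop :=
  Y ⊆ X ∧ ∃ d : ℕ, HasProjDim Y d ∧ HasProjDim X (d + c)

/-- The hypersurface `V(f)`, for a homogeneous polynomial `f`. -/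
def hypersurface (f : MvPolynomial ι K) : Set (ℙ K (ι → K)) :=
  {x | MvPolynomial.eval x.rep f = 0}

/-- `X` is a hypersurface of degree `d`: the zero locus of a form of degree `d` without multiple
factors. -/
def IsHypersurfaceOfDegree (X : Set (ℙ K (ι → K))) (d : ℕ) : Prop :=
  ∃ f : MvPolynomial ι K, Squarefree f ∧ f.IsHomogeneous d ∧ X = hypersurface f

/-! ### Hessian, polar map, dual of a hypersurface -/

/-- The Hessian determinant of `f`. -/
def hessian [Fintype ι] [DecidableEq ι] (f : MvPolynomial ι K) : MvPolynomial ι K :=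
  (Matrix.of fun i j => MvPolynomial.pderiv i (MvPolynomial.pderiv j f)).det

/-- The vector of the first partial derivatives of `f` at `x`. -/
def gradient (f : MvPolynomial ι K) (x : ι → K) : ι → K :=
  fun i => MvPolynomial.eval x (MvPolynomial.pderiv i f)

/-- The polar image of `V(f)`: the closure of the image of the rational map
`[x] ↦ [∇f(x)]`. -/
def polarImage (f : MvPolynomial ι K) : Set (ℙ K (ι → K)) :=
  zariskiClosure (points {y | ∃ x : ι → K, x ≠ 0 ∧ y = gradient f x})

/-- The dual variety of a reduced hypersurface `V(f)`: the closure of the image of its Gauss map,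
which is the restriction of the polar map to `V(f)`. -/
def dualOfHypersurface (f : MvPolynomial ι K) : Set (ℙ K (ι → K)) :=
  zariskiClosure
    (points {y | ∃ x : ι → K, x ≠ 0 ∧ MvPolynomial.eval x f = 0 ∧ y = gradient f x})

/-! ### Dual of an arbitrary irreducible projective variety -/

/-- The linear space of vectors `u` with `∑ i, u i * ∂F/∂x_i (x) = 0`. If `∇F(x) ≠ 0`, it is the
hyperplane tangent to `V(F)` at `[x]`. -/
def tangentHyperplane [Fintype ι] (F : MvPolynomial ι K) (x : ι → K) : Submodule K (ι → K) :=
  LinearMap.ker (∑ i, gradient F x i • (LinearMap.proj i : (ι → K) →ₗ[K] K))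

/-- The affine cone over the embedded projective tangent space of `X` at `x`. -/
def tangentSpace [Fintype ι] (X : Set (ℙ K (ι → K))) (x : ℙ K (ι → K)) : Submodule K (ι → K) :=
  ⨅ F ∈ homIdeal X, tangentHyperplane F x.rep

/-- Smooth points of an irreducible variety in characteristic zero: the points at which the tangent
space has the least dimension. -/
def IsSmoothPoint [Fintype ι] (X : Set (ℙ K (ι → K))) (x : ℙ K (ι → K)) : Prop :=
  x ∈ X ∧ ∀ z ∈ X,
    Module.finrank K (tangentSpace X x) ≤ Module.finrank K (tangentSpace X z)

/-- The dual variety of an irreducible variety `X`: the closure of the set of hyperplanes that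
contain the tangent space of `X` at some smooth point. -/
def dualVariety [Fintype ι] (X : Set (ℙ K (ι → K))) : Set (ℙ K (ι → K)) :=
  zariskiClosure {y | ∃ x, IsSmoothPoint X x ∧ ∀ u ∈ tangentSpace X x, y.rep ⬝ᵥ u = 0}

/-! ### Projections, cones, hyperplane sections -/

/-- The projection of `X` from the linear centre `ℙ(ker T)`: the closure of the image of `X` under
the rational map `[x] ↦ [T x]`. -/
def projection (T : (κ → K) →ₗ[K] (ι → K)) (X : Set (ℙ K (κ → K))) : Set (ℙ K (ι → K)) :=
  zariskiClosure (points {y | ∃ x ∈ X, y = T x.rep})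

/-- The projective subspace `ℙ(L)`. -/
def linearSubspace (L : Submodule K (ι → K)) : Set (ℙ K (ι → K)) := {x | x.rep ∈ L}

/-- The cone over `Y` with vertex `ℙ(ker π)`, for a surjective linear map `π`: it contains the
points of `ℙ(ker π)` and the points whose projection by `π` lies in `Y`. -/
def coneOver (π : (ι → K) →ₗ[K] (κ → K)) (Y : Set (ℙ K (κ → K))) : Set (ℙ K (ι → K)) :=
  {x | ∀ h : π x.rep ≠ 0, Projectivization.mk K (π x.rep) h ∈ Y}

/-- The vertex of `X`: the set of the points `x` of `X` such that for each point `y` of `X` the line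
joining `x` and `y` is contained in `X`. -/
def vertex (X : Set (ℙ K (ι → K))) : Set (ℙ K (ι → K)) :=
  {x | x ∈ X ∧ ∀ y ∈ X, points {v | ∃ a b : K, v = a • x.rep + b • y.rep} ⊆ X}

/-- Coordinates on a linear subspace `H` given by a basis, as a map to the ambient space. -/
def embedding [Fintype ι] {H : Submodule K (κ → K)} (b : Module.Basis ι K H) :
    (ι → K) →ₗ[K] (κ → K) :=
  H.subtype ∘ₗ b.equivFun.symm.toLinearMap

theorem embedding_injective [Fintype ι] {H : Submodule K (κ → K)} (b : Module.Basis ι K H) :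
    Function.Injective (embedding b) :=
  H.injective_subtype.comp b.equivFun.symm.injective

/-- The linear section `X ∩ ℙ(H)`, as a subset of `ℙ(H)` with the coordinates given by the
basis `b`. -/
def linearSection [Fintype ι] {H : Submodule K (κ → K)} (b : Module.Basis ι K H)
    (X : Set (ℙ K (κ → K))) : Set (ℙ K (ι → K)) :=
  {x | Projectivization.map (embedding b) (embedding_injective b) x ∈ X}

/-- The restriction of a polynomial to `H`, in the coordinates given by the basis `b`. -/
def restrict [Fintype ι] {H : Submodule K (κ → K)} (b : Module.Basis ι K H)
    (g : MvPolynomial κ K) : MvPolynomial ι K :=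
  MvPolynomial.aeval
    (fun s => ∑ i, MvPolynomial.C ((b i : κ → K) s) * MvPolynomial.X i) g

/-! ### Symmetric matrices -/

/-- The symmetric matrix of size `m` with the entries `y`, which are indexed by unordered pairs. -/
def symMatrix {R : Type*} {m : ℕ} (y : Sym2 (Fin m) → R) : Matrix (Fin m) (Fin m) R :=
  Matrix.of fun i j => y s(i, j)

/-- The determinant of the generic symmetric matrix of size `m`. -/
def symDet (K : Type*) [Field K] (m : ℕ) : MvPolynomial (Sym2 (Fin m)) K :=
  (symMatrix MvPolynomial.X).det

/-- The symmetric matrices of rank at most `r`. -/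
def symRankLocus (K : Type*) [Field K] (m r : ℕ) : Set (ℙ K (Sym2 (Fin m) → K)) :=
  {x | (symMatrix x.rep).rank ≤ r}

/-- The Veronese variety `ν₂(ℙ^(m-1))`: the symmetric matrices `v vᵗ`, with `v ≠ 0`. -/
def veronese (K : Type*) [Field K] (m : ℕ) : Set (ℙ K (Sym2 (Fin m) → K)) :=
  points {y | ∃ v : Fin m → K, v ≠ 0 ∧ symMatrix y = Matrix.vecMulVec v v}

/-- The trace form `tr (S Y)` on symmetric matrices; it identifies the space of symmetric matrices
with its dual. -/
def traceForm (K : Type*) [Field K] (m : ℕ) :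
    (Sym2 (Fin m) → K) →ₗ[K] (Sym2 (Fin m) → K) →ₗ[K] K :=
  LinearMap.mk₂ K (fun Y S => (symMatrix Y * symMatrix S).trace)
    (fun Y Y' S => by
      have h : symMatrix (Y + Y') = symMatrix Y + symMatrix Y' := rfl
      rw [h, add_mul, Matrix.trace_add])
    (fun c Y S => by
      have h : symMatrix (c • Y) = c • symMatrix Y := rfl
      rw [h, Matrix.smul_mul, Matrix.trace_smul])
    (fun Y S S' => by
      have h : symMatrix (S + S') = symMatrix S + symMatrix S' := rfl
      rw [h, mul_add, Matrix.trace_add])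
    (fun c Y S => by
      have h : symMatrix (c • S) = c • symMatrix S := rfl
      rw [h, Matrix.mul_smul, Matrix.trace_smul])

/-- The hyperplane `p^⊥` of the space of symmetric matrices, for a point `p` of the dual space. -/
def perp {m : ℕ} (p : ℙ K (Sym2 (Fin m) → K)) : Submodule K (Sym2 (Fin m) → K) :=
  LinearMap.ker (traceForm K m p.rep)

/-- The restriction to `p^⊥` of the linear form `S ↦ tr (Y S)`, in the coordinates dual to the
basis `b` of `p^⊥`. It is a surjective linear map whose kernel is the line `p`, so that it induces
the projection from the point `p`. -/
def projectionFrom {m : ℕ} {p : ℙ K (Sym2 (Fin m) → K)} (b : Module.Basis ι K (perp p)) :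
    (Sym2 (Fin m) → K) →ₗ[K] (ι → K) :=
  LinearMap.pi fun i => (traceForm K m).flip (b i : Sym2 (Fin m) → K)

end PolarGeometry

end

/-! A congruence `S ↦ PᵗSP` moves `p` to `e₀e₀ᵗ`. Then `p^⊥` is the space of symmetric matrices with
`S₀₀ = 0`, and `f` is a nonzero multiple of `det` on it (`perpChart`, `restrict_symDet_eq`). The
dual of this space is the space of symmetric matrices modulo `e₀e₀ᵗ`, and by Jacobi's formula the
polar map sends `S` to a multiple of the class of `adj S` (`gradient_eq`).

The lower right block of size `n` does not see the corner entry, so it is defined on classes. Since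
`adj (adj S) = det(S)^(n-1) S`, the determinant of this block of `adj S` equals `det(S)^(n-1) S₀₀ =
0`. This is a relation of degree `n` between the partial derivatives of `f`
(`eval_polarPoly_gradient`), and differentiating it gives a kernel vector of the Hessian matrix.
Conversely, let `y` be a class with singular lower block whose representative `Y` with zero corner
is invertible. Then `adj Y` has zero corner and its polar image is proportional to `y`. Such `y` are
dense in the irreducible hypersurface `V(polarPoly)`, which is therefore the whole polar image
(`homIdeal_points_gradient`). Its equation involves only the block, and singular symmetric matrices
form the dual of the Veronese variety, whence the cone. Its vertex consists of the classes with zero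
block, which have `n` free border entries.

For singular `S` the adjugate is `wwᵗ`. Conversely, every `w` outside the line of `e₀` spans the
kernel of a corank one symmetric matrix with zero corner; this needs size at least three, that is `n
≥ 2`. So the Gauss image is the Veronese variety projected from `p` (`points_gauss_image`).

Irreducibility is checked on arrow matrices, whose determinant has degree one in some variable, with
coprime coefficients. The polar image has a principal ideal, which gives its dimension. The
coordinate ring of the dual embeds in a polynomial ring in `n + 1` variables, from which coordinate
primes are pulled back to a chain of full length (`hasProjDim_rankOneSet`). -/

noncomputable section

namespace PolarGeometry

/-! ### Projective closures and homogeneous polynomials. -/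

section Closure

open MvPolynomial

variable {K : Type*} [Field K] {ι : Type*}

theorem exists_rep_mk_eq_smul (v : ι → K) (hv : v ≠ 0) :
    ∃ a : K, a ≠ 0 ∧ (Projectivization.mk K v hv).rep = a • v := by
  obtain ⟨a, ha⟩ := Projectivization.exists_smul_eq_mk_rep K v hv
  exact ⟨a, a.ne_zero, ha.symm⟩

theorem smul_mem_affineCone {X : Set (ℙ K (ι → K))} {v : ι → K} (hv : v ∈ affineCone X) {c : K}
    (hc : c ≠ 0) : c • v ∈ affineCone X := by
  obtain ⟨h, hX⟩ := hv
  refine ⟨smul_ne_zero hc h, ?_⟩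
  rwa [(Projectivization.mk_eq_mk_iff' K _ _ (smul_ne_zero hc h) h).2 ⟨c, rfl⟩]

theorem rep_mem_affineCone {X : Set (ℙ K (ι → K))}
    {x : ℙ K (ι → K)} : x.rep ∈ affineCone X ↔ x ∈ X := by
  constructor
  · rintro ⟨h, hX⟩
    rwa [Projectivization.mk_rep] at hX
  · intro h
    exact ⟨x.rep_nonzero, by rwa [Projectivization.mk_rep]⟩

theorem mem_homIdeal {X : Set (ℙ K (ι → K))} {F : MvPolynomial ι K} :
    F ∈ homIdeal X ↔ ∀ v ∈ affineCone X, eval v F = 0 := by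
  simp [homIdeal, mem_vanishingIdeal_iff, aeval_eq_eval]

theorem mem_zariskiClosure {X : Set (ℙ K (ι → K))} {x : ℙ K (ι → K)} :
    x ∈ zariskiClosure X ↔ ∀ F ∈ homIdeal X, eval x.rep F = 0 := by
  simp [zariskiClosure, mem_zeroLocus_iff, aeval_eq_eval]

theorem subset_zariskiClosure (X : Set (ℙ K (ι → K))) : X ⊆ zariskiClosure X := fun _ hx =>
  mem_zariskiClosure.2 fun _ hF => mem_homIdeal.1 hF _ (rep_mem_affineCone.2 hx)

theorem affineCone_mono {X Y : Set (ℙ K (ι → K))} (h : X ⊆ Y) :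
    affineCone X ⊆ affineCone Y :=
  fun _ ⟨hv, hX⟩ => ⟨hv, h hX⟩

theorem homIdeal_anti {X Y : Set (ℙ K (ι → K))} (h : X ⊆ Y) : homIdeal Y ≤ homIdeal X :=
  fun _ hF => mem_homIdeal.2 fun v hv => mem_homIdeal.1 hF v (affineCone_mono h hv)

theorem zariskiClosure_mono {X Y : Set (ℙ K (ι → K))} (h : X ⊆ Y) :
    zariskiClosure X ⊆ zariskiClosure Y := fun _ hx =>
  mem_zariskiClosure.2 fun F hF => mem_zariskiClosure.1 hx F (homIdeal_anti h hF)

theorem eval_scale (F : MvPolynomial ι K) (c : K) (v : ι → K) :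
    eval v (aeval (fun i => C c * X i : ι → MvPolynomial ι K) F) = eval (c • v) F := by
  rw [← aeval_eq_eval, ← AlgHom.comp_apply, comp_aeval, aeval_eq_eval]
  congr 2
  ext i
  simp

/-- Membership in the closure is tested at a single representative. The ideal is stable under
scaling of the variables because the cone is stable under nonzero scalars, so the test carries over
to every representative. -/
theorem homIdeal_zariskiClosure (X : Set (ℙ K (ι → K))) :
    homIdeal (zariskiClosure X) = homIdeal X := by
  refine le_antisymm (homIdeal_anti (subset_zariskiClosure X)) fun F hF => ?_
  rw [mem_homIdeal]
  rintro v ⟨hv, hX⟩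
  obtain ⟨a, ha, hrep⟩ := exists_rep_mk_eq_smul v hv
  have h := mem_zariskiClosure.1 hX 
    (aeval (fun i => C a⁻¹ * MvPolynomial.X i) F) (mem_homIdeal.2 fun w hw => by
    rw [eval_scale]
    exact mem_homIdeal.1 hF _ (smul_mem_affineCone hw (inv_ne_zero ha)))
  rwa [eval_scale, hrep, smul_smul, inv_mul_cancel₀ ha, one_smul] at h

theorem eval_smul_of_isHomogeneous {G : MvPolynomial ι K} {d : ℕ} (hG : G.IsHomogeneous d) (c : K)
    (v : ι → K) : eval (c • v) G =
    c ^ d * eval v G := by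
  rw [eval_eq, eval_eq, Finset.mul_sum]
  refine Finset.sum_congr rfl fun m hm => ?_
  have hd : (∑ i ∈ m.support, m i) = d := by
    rw [← Finsupp.degree_apply, Finsupp.degree_eq_weight_one]
    exact hG (mem_support_iff.1 hm)
  simp only [Pi.smul_apply, smul_eq_mul, mul_pow, Finset.prod_mul_distrib, Finset.prod_pow_eq_pow_sum, hd]
  ring

theorem mk_mem_hypersurface {G : MvPolynomial ι K} {d : ℕ} (hG : G.IsHomogeneous d) {v : ι → K}
    (hv : v ≠ 0) : Projectivization.mk K v hv ∈ hypersurface G ↔ eval v G = 0 := by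
  obtain ⟨a, ha, hrep⟩ := exists_rep_mk_eq_smul v hv
  change eval _ G = 0 ↔ _
  rw [hrep, eval_smul_of_isHomogeneous hG]
  simp [ha]

theorem mem_homIdeal_of_subset_hypersurface {G : MvPolynomial ι K} {d : ℕ}
    (hG : G.IsHomogeneous d) {X : Set (ℙ K (ι → K))} (h : X ⊆ hypersurface G) : G ∈ homIdeal X :=
  mem_homIdeal.2 fun _ ⟨hv, hX⟩ => (mk_mem_hypersurface hG hv).1 (h hX)

theorem zariskiClosure_hypersurface {G : MvPolynomial ι K} {d : ℕ} (hG : G.IsHomogeneous d) :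
    zariskiClosure (hypersurface G) = hypersurface G :=
  Set.Subset.antisymm
    (fun _ hx => mem_zariskiClosure.1 hx G (mem_homIdeal_of_subset_hypersurface hG subset_rfl))
    (subset_zariskiClosure _)

/-- The points of a set of vectors depend only on the lines spanned by its nonzero elements. -/
theorem points_subset_points {A B : Set (ι → K)}
    (h : ∀ v ∈ A, v ≠ 0 → ∃ w ∈ B, ∃ c : K, v = c • w) : points A ⊆ points B := by
  rintro _ ⟨v, hv, hv0, rfl⟩
  obtain ⟨w, hw, c, rfl⟩ := h v hv hv0
  have hw0 : w ≠ 0 := fun h => hv0 (by simp [h])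
  exact ⟨w, hw, hw0, (Projectivization.mk_eq_mk_iff' K _ _ hv0 hw0).2 ⟨c, rfl⟩⟩

theorem mem_affineCone_points {A : Set (ι → K)} {v : ι → K} :
    v ∈ affineCone (points A) ↔ v ≠ 0 ∧ ∃ w ∈ A, ∃ c : K, v = c • w := by
  constructor
  · rintro ⟨hv, w, hw, hw0, h⟩
    obtain ⟨c, hc⟩ := (Projectivization.mk_eq_mk_iff' K _ _ hv hw0).1 h
    exact ⟨hv, w, hw, c, hc.symm⟩
  · rintro ⟨hv, w, hw, c, rfl⟩
    have hw0 : w ≠ 0 := fun h => hv (by simp [h])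
    exact ⟨hv, w, hw, hw0, (Projectivization.mk_eq_mk_iff' K _ _ hv hw0).2 ⟨c, rfl⟩⟩

end Closure

/-! ### Linear substitutions, irreducibility, and relations between partial derivatives. -/

section Polynomials

open MvPolynomial

variable {K : Type*} [Field K] {σ τ : Type*}

/-- The chain rule. -/
theorem pderiv_aeval [Fintype σ] (φ : σ → MvPolynomial τ K) (F : MvPolynomial σ K) (j : τ) :
    pderiv j (aeval φ F) = ∑ s, aeval φ (pderiv s F) * pderiv j (φ s) := by
  classical
  induction F using MvPolynomial.induction_on with
  | C a => simp
  | add p q hp hq => simp only [map_add, hp, hq, add_mul, Finset.sum_add_distrib]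
  | mul_X p i hp =>
    simp only [map_mul, Derivation.leibniz, aeval_X, smul_eq_mul, hp, map_add, pderiv_X,
      add_mul, Finset.sum_add_distrib, Finset.mul_sum]
    congr 1
    · rw [Finset.sum_eq_single i]
      · simp
      · intro s _ hs
        simp [hs]
      · simp
    · exact Finset.sum_congr rfl fun s _ => by ring

theorem totalDegree_aeval_le (φ : σ → MvPolynomial τ K) (hφ : ∀ s, (φ s).totalDegree ≤ 1)
    (F : MvPolynomial σ K) : (aeval φ F).totalDegree ≤ F.totalDegree := by
  rw [aeval_def, eval₂_eq]
  refine totalDegree_finsetSum_le fun m hm => ?_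
  refine (totalDegree_mul _ _).trans ?_
  have h1 : (algebraMap K (MvPolynomial τ K) (coeff m F)).totalDegree = 0 := totalDegree_C _
  rw [h1, zero_add]
  refine (totalDegree_finsetProd _ _).trans ?_
  refine le_trans (Finset.sum_le_sum fun i _ => ?_) (le_totalDegree hm)
  exact (totalDegree_pow _ _).trans (by simpa using Nat.mul_le_mul_left (m i) (hφ i))

/-- A polynomial is irreducible if a linear substitution that does not lower its degree makes it
irreducible. -/
theorem irreducible_of_irreducible_aeval (φ : σ → MvPolynomial τ K)
    (hφ : ∀ s, (φ s).totalDegree ≤ 1) (F : MvPolynomial σ K)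
    (hdeg : F.totalDegree ≤ (aeval φ F).totalDegree) (h : Irreducible (aeval φ F)) :
    Irreducible F := by
  have key : ∀ g k : MvPolynomial σ K, F = g * k → IsUnit (aeval φ g) → IsUnit g := by
    intro g k hF hu
    have hF0 : aeval φ F ≠ 0 := h.ne_zero
    have hne : aeval φ g * aeval φ k ≠ 0 := by rwa [← map_mul, ← hF]
    have hgk : g * k ≠ 0 := fun h0 => hF0 (by rw [hF, h0, map_zero])
    -- Degrees add in both factorizations and no factor gains degree. As the product loses none, `g`
    -- cannot lose any either, so a unit image forces `g` to be constant.
    have e1 := totalDegree_mul_of_isDomain (left_ne_zero_of_mul hgk) (right_ne_zero_of_mul hgk)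
    have e2 := totalDegree_mul_of_isDomain (left_ne_zero_of_mul hne) (right_ne_zero_of_mul hne)
    rw [← hF] at e1
    rw [← map_mul, ← hF] at e2
    have e3 := totalDegree_aeval_le φ hφ k
    have e4 : (aeval φ g).totalDegree = 0 := (isUnit_iff_totalDegree_of_isReduced.1 hu).2
    have e5 : g.totalDegree = 0 := by omega
    rw [totalDegree_eq_zero_iff_eq_C] at e5
    rw [e5]
    refine (isUnit_iff_ne_zero.2 fun h0 => left_ne_zero_of_mul hgk ?_).map C
    rw [e5, h0, C_0]
  refine ⟨fun hu => h.not_isUnit (hu.map _), fun g k hF => ?_⟩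
  rcases h.isUnit_or_isUnit (a := aeval φ g) (b := aeval φ k) (by rw [← map_mul, ← hF]) with hu | hu
  · exact Or.inl (key g k hF hu)
  · exact Or.inr (key k g (by rw [hF, mul_comm]) hu)

/-- The linear substitution given by a linear map. -/
def linSubst [Fintype τ] [DecidableEq τ] (L : (τ → K) →ₗ[K] (σ → K)) (s : σ) : MvPolynomial τ K :=
  ∑ t, C (L (Pi.single t 1) s) * X t

theorem eval_linSubst [Fintype τ] [DecidableEq τ] (L : (τ → K) →ₗ[K] (σ → K)) (x : τ → K) (s : σ) :
    eval x (linSubst L s) = L x s := by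
  have h : L x = ∑ t, x t • L (Pi.single t 1) := by
    conv_lhs => rw [pi_eq_sum_univ' x]
    simp only [map_sum, map_smul]
  rw [h]
  simp [linSubst, mul_comm]

theorem eval_aeval_linSubst [Fintype τ] [DecidableEq τ] (L : (τ → K) →ₗ[K] (σ → K)) (x : τ → K)
    (F : MvPolynomial σ K) : eval x (aeval (linSubst L) F) = eval (L x) F := by
  rw [← aeval_eq_eval, ← AlgHom.comp_apply, comp_aeval, aeval_eq_eval]
  congr 2
  ext i
  simp [aeval_eq_eval, eval_linSubst]

theorem isHomogeneous_linSubst [Fintype τ] [DecidableEq τ] (L : (τ → K) →ₗ[K] (σ → K)) (s : σ) :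
    (linSubst L s).IsHomogeneous 1 :=
  IsHomogeneous.sum _ _ _ fun _ _ => isHomogeneous_C_mul_X _ _

theorem isHomogeneous_aeval_linSubst [Fintype τ] [DecidableEq τ] (L : (τ → K) →ₗ[K] (σ → K))
    {F : MvPolynomial σ K} {d : ℕ} (hF : F.IsHomogeneous d) :
    (aeval (linSubst L) F).IsHomogeneous d := by
  simpa using hF.aeval (linSubst L) (isHomogeneous_linSubst L)

theorem eval_pderiv_linSubst [Fintype τ] [DecidableEq τ] (L : (τ → K) →ₗ[K] (σ → K)) (s : σ)
    (t : τ) (x : τ → K) : eval x (pderiv t (linSubst L s)) = L (Pi.single t 1) s := by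
  simp [linSubst, pderiv_X, Pi.single_apply]

theorem gradient_aeval_linSubst [Fintype σ] [Fintype τ] [DecidableEq τ]
    (L : (τ → K) →ₗ[K] (σ → K)) (F : MvPolynomial σ K) (x : τ → K) (t : τ) :
    gradient (aeval (linSubst L) F) x t = ∑ s, gradient F (L x) s * L (Pi.single t 1) s := by
  simp only [gradient, pderiv_aeval, map_sum, map_mul, eval_aeval_linSubst, eval_pderiv_linSubst]

/-- The Hessian vanishes if the polar map satisfies an algebraic relation at a smooth point. -/
theorem hessian_eq_zero_of_relation [Fintype σ] [DecidableEq σ] (F G : MvPolynomial σ K)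
    (h : aeval (fun i => pderiv i F) G = 0)
    (hne : ∃ i, aeval (fun i => pderiv i F) (pderiv i G) ≠ 0) : hessian F = 0 := by
  rw [hessian, ← Matrix.exists_mulVec_eq_zero_iff]
  refine ⟨fun i => aeval (fun i => pderiv i F) (pderiv i G), ?_, ?_⟩
  · obtain ⟨i, hi⟩ := hne
    exact fun h0 => hi (congrFun h0 i)
  · ext1 j
    -- By the chain rule, row `j` of the Hessian matrix applied to `∇G(∇F)` is the `j`-th derivative
    -- of `G(∇F) = 0`.
    have h1 := pderiv_aeval (fun i => pderiv i F) G j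
    rw [h, map_zero] at h1
    rw [Pi.zero_apply, h1]
    exact Finset.sum_congr rfl fun i _ => mul_comm _ _

end Polynomials

/-! ### Krull dimension of coordinate rings. -/

section Dimension

open MvPolynomial

theorem natCast_le_ringKrullDim_of_strictMono {R : Type*} [CommRing R] {k : ℕ}
    (P : Fin (k + 1) → PrimeSpectrum R) (hP : StrictMono P) : (k : WithBot ℕ∞) ≤ ringKrullDim R :=
  Order.LTSeries.length_le_krullDim (LTSeries.mk k P hP)

/-- Incomparability: strict chains of primes stay strict under contraction along an integral map. -/
theorem ringKrullDim_le_of_isIntegral {R S : Type*} [CommRing R] [CommRing S] (f : R →+* S)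
    (hf : f.IsIntegral) : ringKrullDim S ≤ ringKrullDim R := by
  algebraize [f]
  refine Order.krullDim_le_of_strictMono (PrimeSpectrum.comap f) fun I J h => ?_
  exact Ideal.IsIntegral.comap_lt_comap h

variable {K : Type*} [Field K]

/-- The dimension of a finitely generated algebra that embeds in a polynomial ring is at most the
number of variables. -/
theorem ringKrullDim_le_of_injective {A : Type*} [CommRing A] [Nontrivial A] [Algebra K A] [Algebra.FiniteType K A]
    {m : ℕ} (f : A →ₐ[K] MvPolynomial (Fin m) K) (hf : Function.Injective f) :
    ringKrullDim A ≤ m := by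
  -- Noether normalization bounds the dimension by `s`. Composing with `f` embeds a polynomial ring
  -- in `s` variables into one in `m`, so `s ≤ m` by transcendence degree.
  obtain ⟨s, g, hg, hint⟩ := exists_integral_inj_algHom_of_fg K A
  have h1 := ringKrullDim_le_of_isIntegral g.toRingHom hint
  rw [MvPolynomial.ringKrullDim_of_isNoetherianRing, ringKrullDim_eq_zero_of_field] at h1
  have h2 := trdeg_le_of_injective (f.comp g) (hf.comp hg)
  simp only [MvPolynomial.trdeg_of_isDomain] at h2
  have h3 : s ≤ m := by simpa using h2
  refine h1.trans ?_
  simpa using h3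

/-- The ideal of the coordinate subspace on which the first `j` coordinates vanish. -/
def coordIdeal (K : Type*) [Field K] (k : ℕ) (j : ℕ) : Ideal (MvPolynomial (Fin k) K) :=
  RingHom.ker (aeval (fun i : Fin k => if (i : ℕ) < j then 0 else X i) :
    MvPolynomial (Fin k) K →ₐ[K] MvPolynomial (Fin k) K)

instance coordIdeal_isPrime (k j : ℕ) : (coordIdeal K k j).IsPrime := RingHom.ker_isPrime _

theorem X_mem_coordIdeal {k j : ℕ} {i : Fin k} : X i ∈ coordIdeal K k j ↔ (i : ℕ) < j := by
  simp [coordIdeal, RingHom.mem_ker]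

theorem coordIdeal_mono (k : ℕ) : Monotone (coordIdeal K k) := by
  intro j l h F hF
  have hcomp : (aeval (fun i : Fin k => if (i : ℕ) < l then 0 else X i) :
      MvPolynomial (Fin k) K →ₐ[K] MvPolynomial (Fin k) K) =
      (aeval (fun i : Fin k => if (i : ℕ) < l then 0 else X i) :
      MvPolynomial (Fin k) K →ₐ[K] MvPolynomial (Fin k) K).comp
      (aeval (fun i : Fin k => if (i : ℕ) < j then 0 else X i)) := by
    ext1 i
    by_cases h1 : (i : ℕ) < j
    · simp [h1, h1.trans_le h]
    · simp [h1]
  rw [coordIdeal, RingHom.mem_ker] at hF ⊢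
  rw [hcomp, AlgHom.comp_apply, hF, map_zero]

/-- The maximal ideal of the origin contains `G` and has height at least `k`, by the flag of
coordinate ideals. Dividing by one element costs at most one in height. -/
theorem le_ringKrullDim_quotient {k : ℕ} (G : MvPolynomial (Fin k) K) (hG : eval 0 G = 0) :
    (k : WithBot ℕ∞) ≤ ringKrullDim (MvPolynomial (Fin k) K ⧸ Ideal.span {G}) + 1 := by
  have hmem : G ∈ coordIdeal K k k := by
    have : (fun i : Fin k => if (i : ℕ) < k then 0 else (X i : MvPolynomial (Fin k) K)) =
        fun i => C (0 : K) := by ext1 i; simp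
    rw [coordIdeal, RingHom.mem_ker, this]
    have h2 := aeval_algebraMap_apply (MvPolynomial (Fin k) K) (0 : Fin k → K) G
    rw [aeval_eq_eval, hG, map_zero] at h2
    exact h2
  refine le_trans ?_ (Ideal.height_le_ringKrullDim_quotient_add_one hmem)
  let s : LTSeries (PrimeSpectrum (MvPolynomial (Fin k) K)) :=
    LTSeries.mk k (fun j => ⟨coordIdeal K k j, inferInstance⟩) (Fin.strictMono_iff_lt_succ.2 fun i =>
      lt_of_le_not_ge (coordIdeal_mono k (by simp)) fun h => by
        have h1 := h (X_mem_coordIdeal.2 (by simp) : X i ∈ coordIdeal K k _)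
        have h2 := X_mem_coordIdeal.1 h1
        simp at h2)
  have := Order.length_le_height_last (p := s)
  have hl : s.last = ⟨coordIdeal K k k, inferInstance⟩ := rfl
  rw [hl, ← PrimeSpectrum.height_eq_orderHeight] at this
  exact_mod_cast this

/-- The lower bound comes from the origin, where `G` vanishes; the upper bound holds because `G` is
a nonzerodivisor. -/
theorem ringKrullDim_quotient_span_singleton {ι : Type*} [Fintype ι] (G : MvPolynomial ι K)
    (hG0 : G ≠ 0) (hG : eval 0 G = 0) {k : ℕ} (hk : Fintype.card ι = k + 1) :
    ringKrullDim (MvPolynomial ι K ⧸ Ideal.span {G}) = k := by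
  have e : ι ≃ Fin (k + 1) := Fintype.equivFinOfCardEq hk
  let r := (renameEquiv K e).toRingEquiv
  have h1 : ringKrullDim (MvPolynomial ι K ⧸ Ideal.span {G}) =
      ringKrullDim (MvPolynomial (Fin (k + 1)) K ⧸ Ideal.span {r G}) :=
    ringKrullDim_eq_of_ringEquiv (Ideal.quotientEquiv _ _ r (by
      rw [Ideal.map_span, Set.image_singleton]; rfl))
  have h2 : ((k + 1 : ℕ) : WithBot ℕ∞) ≤
      ringKrullDim (MvPolynomial (Fin (k + 1)) K ⧸ Ideal.span {r G}) + 1 :=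
    le_ringKrullDim_quotient (r G) (by
      change eval 0 (rename e G) = 0
      rw [eval_rename]
      exact hG)
  have h3 := ringKrullDim_quotient_succ_le_of_nonZeroDivisor (r := r G)
    (mem_nonZeroDivisors_of_ne_zero (by simpa using hG0))
  rw [MvPolynomial.ringKrullDim_of_isNoetherianRing, ringKrullDim_eq_zero_of_field, zero_add,
    Nat.card_fin] at h3
  rw [h1]
  have h4 := h3.antisymm h2
  push_cast at h4
  -- Cancelling `+ 1` is legitimate only for finite values, so `⊥` and `⊤` are excluded first.
  generalize ringKrullDim (MvPolynomial (Fin (k + 1)) K ⧸ Ideal.span {r G}) = d at h4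
  induction d using WithBot.recBotCoe with
  | bot => exact absurd h4 (by rw [WithBot.bot_add]; exact WithBot.bot_ne_coe)
  | coe d =>
    induction d using ENat.recTopCoe with
    | top => exact absurd h4 (by norm_cast; exact ENat.top_ne_natCast _)
    | coe d =>
      norm_cast at h4 ⊢
      omega

end Dimension

end PolarGeometry

end

noncomputable section

namespace PolarGeometry

/-! ### Jacobi's formula. -/

section Jacobi

variable {R A : Type*} [CommRing R] [CommRing A] [Algebra R A]

theorem derivation_prod {ι : Type*} [DecidableEq ι] (D : Derivation R A A) (s : Finset ι)
    (f : ι → A) : D (∏ i ∈ s, f i) = ∑ i ∈ s, (∏ j ∈ s.erase i, f j) * D (f i) := by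
  induction s using Finset.induction_on with
  | empty => simp
  | insert a s ha ih =>
    rw [Finset.prod_insert ha, Derivation.leibniz, ih, Finset.sum_insert ha,
      Finset.erase_insert ha, smul_eq_mul, smul_eq_mul, Finset.mul_sum, add_comm]
    congr 1
    refine Finset.sum_congr rfl fun i hi => ?_
    have hne : a ≠ i := fun h => ha (h ▸ hi)
    rw [Finset.erase_insert_of_ne hne, Finset.prod_insert (by simp [ha])]
    ring

/-- Jacobi's formula for the derivative of a determinant. -/
theorem derivation_det {m : Type*} [Fintype m] [DecidableEq m] (D : Derivation R A A)
    (M : Matrix m m A) : D M.det = ∑ i, ∑ j, M.adjugate i j * D (M j i) := by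
  -- By Cramer's rule the inner sum is the determinant with column `i` differentiated; what remains
  -- is the product rule in the permutation expansion.
  have h1 : ∀ i, (M.updateCol i fun k => D (M k i)).det = ∑ j, M.adjugate i j * D (M j i) := by
    intro i
    rw [← Matrix.cramer_apply, Matrix.cramer_eq_adjugate_mulVec]
    rfl
  simp_rw [← h1, Matrix.det_apply, map_sum]
  rw [Finset.sum_comm]
  refine Finset.sum_congr rfl fun p _ => ?_
  rw [← Finset.smul_sum, Units.smul_def, map_zsmul, derivation_prod, Units.smul_def]
  congr 1
  refine Finset.sum_congr rfl fun i _ => ?_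
  rw [← Finset.mul_prod_erase _ _ (Finset.mem_univ i), Matrix.updateCol_self, mul_comm]
  congr 1
  refine Finset.prod_congr rfl fun j hj => ?_
  rw [Matrix.updateCol_ne (Finset.ne_of_mem_erase hj)]

end Jacobi

/-! ### Symmetric matrices, their determinant, and the trace form. -/

section SymMatrix

open MvPolynomial

variable {K : Type*} [Field K] {m : ℕ}

@[simp]
theorem symMatrix_apply {R : Type*} (y : Sym2 (Fin m) → R) (i j : Fin m) :
    symMatrix y i j = y s(i, j) := rfl

theorem symMatrix_add (y z : Sym2 (Fin m) → K) : symMatrix (y + z) = symMatrix y + symMatrix z :=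
  rfl

theorem symMatrix_smul (c : K) (y : Sym2 (Fin m) → K) : symMatrix (c • y) = c • symMatrix y := rfl

theorem isSymm_symMatrix {R : Type*} (y : Sym2 (Fin m) → R) : (symMatrix y).IsSymm := by
  ext i j
  simp [Sym2.eq_swap]

theorem symMatrix_injective {R : Type*} :
    Function.Injective (symMatrix : (Sym2 (Fin m) → R) → Matrix (Fin m) (Fin m) R) := by
  intro y z h
  ext s
  induction s with
  | _ i j => exact congrFun (congrFun h i) j

/-- The coordinates of the symmetric part of a matrix. -/
def symCoords (K : Type*) [Field K] (m : ℕ) :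
    Matrix (Fin m) (Fin m) K →ₗ[K] (Sym2 (Fin m) → K) where
  toFun M s := Sym2.lift ⟨fun i j => (M i j + M j i) / 2, fun i j => by simp only [add_comm]⟩ s
  map_add' M N := by
    ext s
    induction s with
    | _ i j => simp; ring
  map_smul' c M := by
    ext s
    induction s with
    | _ i j => simp; ring

theorem symCoords_mk (M : Matrix (Fin m) (Fin m) K) (i j : Fin m) :
    symCoords K m M s(i, j) = (M i j + M j i) / 2 := rfl

theorem symMatrix_symCoords [CharZero K] {M : Matrix (Fin m) (Fin m) K} (hM : M.IsSymm) :
    symMatrix (symCoords K m M) = M := by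
  ext i j
  rw [symMatrix_apply, symCoords_mk, hM.apply i j]
  ring

theorem eval_symDet (y : Sym2 (Fin m) → K) : eval y (symDet K m) = (symMatrix y).det := by
  rw [symDet, RingHom.map_det]
  congr 1
  ext i j
  simp

theorem isHomogeneous_symDet : (symDet K m).IsHomogeneous m := by
  rw [symDet, Matrix.det_apply]
  refine IsHomogeneous.sum _ _ _ fun p _ => ?_
  rw [Units.smul_def, zsmul_eq_mul, ← map_intCast (C : K →+* MvPolynomial _ K)]
  refine IsHomogeneous.C_mul ?_ _
  have h := IsHomogeneous.prod Finset.univ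
    (fun i => (symMatrix X : Matrix (Fin m) (Fin m) (MvPolynomial (Sym2 (Fin m)) K)) (p i) i)
    (fun _ => 1) fun i _ => isHomogeneous_X _ _
  simpa using h

/-- The gradient of the symmetric determinant is the adjugate matrix, by the trace form. -/
theorem sum_gradient_symDet (y u : Sym2 (Fin m) → K) :
    ∑ s, gradient (symDet K m) y s * u s = ((symMatrix y).adjugate * symMatrix u).trace := by
  have h1 : ∀ s, gradient (symDet K m) y s =
      ∑ i, ∑ j, (symMatrix y).adjugate i j * if s(j, i) = s then 1 else 0 := by
    intro s
    rw [gradient, symDet, derivation_det, map_sum]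
    refine Finset.sum_congr rfl fun i _ => ?_
    rw [map_sum]
    refine Finset.sum_congr rfl fun j _ => ?_
    have h2 : (eval y) ((symMatrix X : Matrix (Fin m) (Fin m) (MvPolynomial _ K)).adjugate i j) =
        (symMatrix y).adjugate i j := by
      have h3 := RingHom.map_adjugate (eval y)
        (symMatrix X : Matrix (Fin m) (Fin m) (MvPolynomial _ K))
      have h4 : (eval y).mapMatrix (symMatrix X) = symMatrix y := by
        ext i j
        simp
      rw [h4] at h3
      rw [← h3]
      rfl
    rw [map_mul, h2, symMatrix_apply, pderiv_X, Pi.single_apply]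
    congr 1
    split_ifs with h <;> simp_all
  simp only [h1, Matrix.trace, Matrix.diag, Matrix.mul_apply, Finset.sum_mul]
  rw [Finset.sum_comm]
  refine Finset.sum_congr rfl fun i _ => ?_
  rw [Finset.sum_comm]
  refine Finset.sum_congr rfl fun j _ => ?_
  simp

/-- An off-diagonal unordered pair comes from two ordered pairs. This is the source of the factors
two that `halfOff` removes. -/
theorem sum_sum_sym2 (g : Sym2 (Fin m) → K) :
    ∑ i, ∑ j, g s(i, j) = ∑ s, (if s.IsDiag then 1 else 2) * g s := by
  rw [← Fintype.sum_prod_type', ← Finset.sum_fiberwise (s := Finset.univ)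
    (g := fun q : Fin m × Fin m => s(q.1, q.2))]
  refine Finset.sum_congr rfl fun s _ => ?_
  rw [Finset.sum_congr rfl fun q hq => by rw [(Finset.mem_filter.1 hq).2], Finset.sum_const,
    nsmul_eq_mul]
  congr 1
  induction s with
  | _ a b =>
    have : (Finset.univ.filter fun q : Fin m × Fin m => s(q.1, q.2) = s(a, b)) =
        {(a, b), (b, a)} := by
      ext ⟨c, d⟩
      simp
    rw [this]
    by_cases hab : a = b
    · simp [hab]
    · rw [Finset.card_pair (by simp [hab])]
      simp [hab]

theorem trace_mul_symMatrix (M : Matrix (Fin m) (Fin m) K) (u : Sym2 (Fin m) → K) :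
    (M * symMatrix u).trace = ∑ i, ∑ j, M i j * u s(i, j) := by
  simp only [Matrix.trace, Matrix.diag, Matrix.mul_apply, symMatrix_apply]
  exact Finset.sum_congr rfl fun i _ => Finset.sum_congr rfl fun j _ => by rw [Sym2.eq_swap]

/-- The off-diagonal coordinates are halved. The dual of the identification of `y` with
`symMatrix y` identifies `z` with `symMatrix (halfOff z)`. -/
def halfOff (K : Type*) [Field K] (m : ℕ) : (Sym2 (Fin m) → K) →ₗ[K] (Sym2 (Fin m) → K) where
  toFun z s := if s.IsDiag then z s else z s / 2
  map_add' y z := by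
    ext s
    simp only [Pi.add_apply]
    split_ifs <;> ring
  map_smul' c z := by
    ext s
    simp only [Pi.smul_apply, smul_eq_mul, RingHom.id_apply]
    split_ifs <;> ring

/-- The halved entries compensate for the double occurrence of off-diagonal coordinates. This
translates the dot product, in which gradients and dual varieties are expressed, into the trace
form. -/
theorem trace_symMatrix_halfOff [CharZero K] (z u : Sym2 (Fin m) → K) :
    (symMatrix (halfOff K m z) * symMatrix u).trace = ∑ s, z s * u s := by
  rw [trace_mul_symMatrix]
  simp only [symMatrix_apply]
  rw [sum_sum_sym2 fun s => halfOff K m z s * u s]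
  refine Finset.sum_congr rfl fun s _ => ?_
  simp only [halfOff, LinearMap.coe_mk, AddHom.coe_mk]
  split_ifs <;> ring

/-- The coefficients of the linear form `U ↦ tr (M U)`. -/
def traceCoords (K : Type*) [Field K] (m : ℕ) :
    Matrix (Fin m) (Fin m) K →ₗ[K] (Sym2 (Fin m) → K) where
  toFun M s := (M * symMatrix (Pi.single s 1)).trace
  map_add' M N := by
    ext s
    simp [add_mul]
  map_smul' c M := by
    ext s
    simp

theorem sum_traceCoords (M : Matrix (Fin m) (Fin m) K) (u : Sym2 (Fin m) → K) :
    ∑ s, traceCoords K m M s * u s = (M * symMatrix u).trace := by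
  have hu : symMatrix u = ∑ s, u s • symMatrix (Pi.single s 1) := by
    ext i j
    simp [Matrix.sum_apply, Pi.single_apply]
  rw [hu]
  simp [traceCoords, Matrix.mul_sum, Matrix.trace_sum, mul_comm]

/-- Nondegeneracy of the trace form: a unit coordinate vector isolates one entry with multiplicity
one or two, which is invertible in characteristic zero. -/
theorem symMatrix_eq_of_trace_eq [CharZero K] {Y Z : Matrix (Fin m) (Fin m) K} (hY : Y.IsSymm)
    (hZ : Z.IsSymm)
    (h : ∀ u : Sym2 (Fin m) → K, (Y * symMatrix u).trace = (Z * symMatrix u).trace) : Y = Z := by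
  rw [← symMatrix_symCoords hY, ← symMatrix_symCoords hZ] at h ⊢
  congr 1
  ext s
  have h1 := h (Pi.single s 1)
  simp only [trace_mul_symMatrix, symMatrix_apply] at h1
  rw [sum_sum_sym2 fun t => symCoords K m Y t * Pi.single (M := fun _ => K) s 1 t,
    sum_sum_sym2 fun t => symCoords K m Z t * Pi.single (M := fun _ => K) s 1 t] at h1
  simp only [Pi.single_apply, mul_ite, mul_one, mul_zero, Finset.sum_ite_eq', Finset.mem_univ,
    if_true] at h1
  refine mul_left_cancel₀ ?_ h1
  split_ifs <;> norm_num

theorem symMatrix_halfOff_traceCoords [CharZero K] {M : Matrix (Fin m) (Fin m) K} (hM : M.IsSymm) :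
    symMatrix (halfOff K m (traceCoords K m M)) = M :=
  symMatrix_eq_of_trace_eq (isSymm_symMatrix _) hM fun u => by
    rw [trace_symMatrix_halfOff, sum_traceCoords]

theorem traceCoords_symMatrix_halfOff [CharZero K] (z : Sym2 (Fin m) → K) :
    traceCoords K m (symMatrix (halfOff K m z)) = z := by
  ext s
  change (symMatrix (halfOff K m z) * symMatrix (Pi.single s 1)).trace = _
  rw [trace_symMatrix_halfOff]
  simp [Pi.single_apply]

end SymMatrix

/-! ### Adjugates of singular matrices and their behaviour under congruence. -/

section Adjugate

open Matrix

variable {K : Type*} [Field K]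

/-- The adjugate of a singular matrix has rank at most one. -/
theorem adjugate_mul_adjugate_apply {m : Type*} [Fintype m] [DecidableEq m] {S : Matrix m m K}
    (hS : S.det = 0) (i j k l : m) :
    S.adjugate i j * S.adjugate k l = S.adjugate i l * S.adjugate k j := by
  by_cases h : S.adjugate i j = 0 ∧ S.adjugate i l = 0
  · rw [h.1, h.2, zero_mul, zero_mul]
  have main : ∀ j l, S.adjugate i j ≠ 0 →
      S.adjugate i j * S.adjugate k l = S.adjugate i l * S.adjugate k j := by
    intro j l hij
    have hdet : (S.updateRow j (Pi.single i 1)).det ≠ 0 := by rwa [← Matrix.adjugate_apply]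
    have hmul : S * S.adjugate = 0 := by rw [Matrix.mul_adjugate, hS, zero_smul]
    -- `z` combines two columns of `adj S`, both killed by `S`, so that its `i`-th entry vanishes.
    -- It is therefore killed by `S` with row `j` replaced by `eᵢ`, whose determinant is the nonzero
    -- entry `adj S i j`.
    let z : m → K := fun a => S.adjugate i j * S.adjugate a l - S.adjugate i l * S.adjugate a j
    have hz : S.updateRow j (Pi.single i 1) *ᵥ z = 0 := by
      ext a
      by_cases ha : a = j
      · subst ha
        simp [Matrix.mulVec, z, mul_comm]
      · have e : ∀ b, ∑ c, S a c * S.adjugate c b = 0 := fun b => by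
          rw [← Matrix.mul_apply, hmul, Matrix.zero_apply]
        simp only [Matrix.mulVec, dotProduct, Matrix.updateRow_ne ha, z, mul_sub,
          Finset.sum_sub_distrib, mul_left_comm (S a _), ← Finset.mul_sum, e, mul_zero, sub_zero,
          Pi.zero_apply]
    have hz0 := Matrix.eq_zero_of_mulVec_eq_zero hdet hz
    exact sub_eq_zero.1 (congrFun hz0 k)
  by_cases hij : S.adjugate i j = 0
  · have hil : S.adjugate i l ≠ 0 := fun h0 => h ⟨hij, h0⟩
    exact (main l j hil).symm
  · exact main j l hij

/-- The vanishing of the two by two minors makes a column divided by the square root of its nonzero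
diagonal entry work. If the diagonal is zero, the minors force all entries to vanish. -/
theorem exists_adjugate_eq_vecMulVec [IsAlgClosed K] {m : Type*} [Fintype m] [DecidableEq m]
    {S : Matrix m m K} (hsymm : S.IsSymm) (hS : S.det = 0) :
    ∃ w : m → K, S.adjugate = Matrix.vecMulVec w w := by
  have hadj : S.adjugate.IsSymm := hsymm.adjugate
  have hmul := adjugate_mul_adjugate_apply hS
  by_cases h : ∀ i, S.adjugate i i = 0
  · refine ⟨0, ?_⟩
    ext i j
    have := hmul i j i j
    have h2 := hmul i i j j
    rw [h i, zero_mul, hadj.apply i j] at h2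
    simpa using h2.symm
  · push Not at h
    obtain ⟨i, hi⟩ := h
    obtain ⟨t, ht⟩ := IsAlgClosed.exists_pow_nat_eq (S.adjugate i i) (n := 2) (by norm_num)
    have ht0 : t ≠ 0 := fun h0 => hi (by rw [← ht, h0]; ring)
    refine ⟨fun k => S.adjugate k i / t, ?_⟩
    ext k l
    have h1 := hmul i i k l
    rw [Matrix.vecMulVec_apply, div_mul_div_comm, ← sq, ht, eq_div_iff hi, mul_comm, h1,
      hadj.apply l i, mul_comm]

theorem adjugate_eq_det_smul {m : Type*} [Fintype m] [DecidableEq m] {P Q : Matrix m m K}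
    (h : P * Q = 1) : Q.adjugate = Q.det • P := by
  have h1 := congrArg (P * ·) (Matrix.mul_adjugate Q)
  simpa [← Matrix.mul_assoc, h] using h1

/-- The adjugate transforms by the inverse congruence, so a normal form whose kernel is a basis
vector gives matrices whose kernel is any prescribed line. -/
theorem adjugate_congr {m : Type*} [Fintype m] [DecidableEq m] {P Q : Matrix m m K}
    (h : P * Q = 1) (D : Matrix m m K) :
    (Q.transpose * D * Q).adjugate = (Q.det ^ 2) • (P * D.adjugate * P.transpose) := by
  have h2 : Q.transpose.adjugate = Q.det • P.transpose := by
    rw [← Matrix.adjugate_transpose, adjugate_eq_det_smul h, Matrix.transpose_smul]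
  rw [Matrix.adjugate_mul_distrib, Matrix.adjugate_mul_distrib, adjugate_eq_det_smul h, h2]
  simp [smul_smul, sq, Matrix.mul_assoc]

/-- Linearly independent vectors are the first columns of an invertible matrix. -/
theorem exists_mul_eq_one_of_linearIndependent {r m : ℕ} (v : Fin r → Fin m → K)
    (hv : LinearIndependent K v) (hr : r ≤ m) :
    ∃ P Q : Matrix (Fin m) (Fin m) K, P * Q = 1 ∧ Q * P = 1 ∧
      ∀ i j, P j (Fin.castLE hr i) = v i j := by
  classical
  let b := Module.Basis.sumExtend hv
  have : Fintype (Fin r ⊕ Module.Basis.sumExtendIndex hv) := FiniteDimensional.fintypeBasisIndex b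
  have : Fintype (Module.Basis.sumExtendIndex hv) := Fintype.ofInjective
    (fun x => (Sum.inr x : Fin r ⊕ Module.Basis.sumExtendIndex hv)) Sum.inr_injective
  have hcard : Fintype.card (Module.Basis.sumExtendIndex hv) = m - r := by
    have h1 := Module.finrank_eq_card_basis b
    rw [Module.finrank_fin_fun, ← Nat.card_eq_fintype_card, Nat.card_sum, Nat.card_eq_fintype_card,
      Nat.card_eq_fintype_card, Fintype.card_fin] at h1
    omega
  let e : Fin r ⊕ Module.Basis.sumExtendIndex hv ≃ Fin m :=
    ((Equiv.refl _).sumCongr (Fintype.equivFinOfCardEq hcard)).trans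
      (finSumFinEquiv.trans (finCongr (by omega)))
  let b' := b.reindex e
  let P : Matrix (Fin m) (Fin m) K := Matrix.of fun i j => b' j i
  have hP : P = (Pi.basisFun K (Fin m)).toMatrix b' := by
    ext i j
    simp [P, Module.Basis.toMatrix_apply]
  refine ⟨P, b'.toMatrix (Pi.basisFun K (Fin m)), ?_, ?_, fun i j => ?_⟩
  · rw [hP, Module.Basis.toMatrix_mul_toMatrix_flip]
  · rw [hP, Module.Basis.toMatrix_mul_toMatrix_flip]
  · have he : e.symm (Fin.castLE hr i) = Sum.inl i := by
      rw [Equiv.symm_apply_eq]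
      ext
      simp [e]
    change b' _ j = _
    rw [Module.Basis.reindex_apply, he]
    have h1 : b (Sum.inl i) = v i := by
      simp only [b, Module.Basis.sumExtend, Module.Basis.reindex_apply]
      rw [Module.Basis.extend_apply_self]
      rfl
    rw [h1]

end Adjugate

end PolarGeometry

end

noncomputable section

namespace PolarGeometry

/-! ### Corank one symmetric matrices with prescribed kernel. -/

section Singular

variable {K : Type*} [Field K]

theorem adjugate_diagonal_update {m : Type*} [Fintype m] [DecidableEq m] (k : m) :
    (Matrix.diagonal (Function.update 1 k 0 : m → K)).adjugate =
      Matrix.vecMulVec (Pi.single k 1) (Pi.single k 1) := by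
  rw [Matrix.adjugate_diagonal]
  ext i j
  by_cases hij : i = j
  · subst hij
    rw [Matrix.diagonal_apply_eq, Matrix.vecMulVec_apply]
    by_cases hik : i = k
    · subst hik
      rw [Finset.prod_eq_one fun j hj => by
        rw [Function.update_of_ne (Finset.ne_of_mem_erase hj), Pi.one_apply]]
      simp
    · rw [Finset.prod_eq_zero (Finset.mem_erase.2 ⟨Ne.symm hik, Finset.mem_univ k⟩) (by simp)]
      simp [hik]
  · rw [Matrix.diagonal_apply_ne _ hij, Matrix.vecMulVec_apply]
    by_cases hik : i = k
    · subst hik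
      simp [Ne.symm hij]
    · simp [hik]

theorem mul_vecMulVec_mul_transpose {m : Type*} [Fintype m] [DecidableEq m] (P : Matrix m m K)
    (w : m → K) :
    P * Matrix.vecMulVec w w * P.transpose = Matrix.vecMulVec (P.mulVec w) (P.mulVec w) := by
  rw [Matrix.mul_vecMulVec, Matrix.vecMulVec_mul, Matrix.vecMul_transpose]

theorem isSymm_congr {m : Type*} [Fintype m] {D : Matrix m m K}
    (hD : D.IsSymm) (Q : Matrix m m K) : (Q.transpose * D * Q).IsSymm := by
  rw [Matrix.IsSymm, Matrix.transpose_mul, Matrix.transpose_mul, Matrix.transpose_transpose, hD,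
    Matrix.mul_assoc]

theorem exists_invertible_of_ne_zero {m : ℕ} {v : Fin (m + 1) → K} (hv : v ≠ 0) :
    ∃ P Q : Matrix (Fin (m + 1)) (Fin (m + 1)) K, P * Q = 1 ∧ Q * P = 1 ∧
      P.mulVec (Pi.single 0 1) = v := by
  obtain ⟨P, Q, h1, h2, h3⟩ := exists_mul_eq_one_of_linearIndependent (fun _ : Fin 1 => v)
    (LinearIndependent.of_subsingleton 0 hv) (by omega : 1 ≤ m + 1)
  refine ⟨P, Q, h1, h2, ?_⟩
  ext j
  simpa using h3 0 j

theorem det_ne_zero_of_mul_eq_one {m : Type*} [Fintype m] [DecidableEq m] {P Q : Matrix m m K}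
    (h : P * Q = 1) : Q.det ≠ 0 := fun h0 => by
  have := congrArg Matrix.det h
  rw [Matrix.det_mul, h0, mul_zero, Matrix.det_one] at this
  exact zero_ne_one this

/-- Every line is the kernel of a symmetric matrix of corank one. -/
theorem exists_isSymm_adjugate {m : ℕ} {v : Fin (m + 1) → K} (hv : v ≠ 0) :
    ∃ S : Matrix (Fin (m + 1)) (Fin (m + 1)) K, S.IsSymm ∧ S.det = 0 ∧ S.rank = m ∧
      ∃ c : K, c ≠ 0 ∧ S.adjugate = c • Matrix.vecMulVec v v := by
  classical
  obtain ⟨P, Q, h1, h2, h3⟩ := exists_invertible_of_ne_zero hv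
  -- The form `diag(0, 1, …, 1)` has kernel `e₀`, and `Q` sends `v` to `e₀`.
  refine ⟨Q.transpose * Matrix.diagonal (Function.update 1 0 0) * Q,
    isSymm_congr (Matrix.isSymm_diagonal _) _, ?_, ?_, Q.det ^ 2,
    pow_ne_zero 2 (det_ne_zero_of_mul_eq_one h1), ?_⟩
  · rw [Matrix.det_mul, Matrix.det_mul, Matrix.det_diagonal,
      Finset.prod_eq_zero (Finset.mem_univ 0) (by simp)]
    ring
  · have hQ : IsUnit Q.det := (det_ne_zero_of_mul_eq_one h1).isUnit
    rw [Matrix.rank_mul_eq_left_of_isUnit_det _ _ hQ,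
      Matrix.rank_mul_eq_right_of_isUnit_det _ _ (by rwa [Matrix.det_transpose]),
      Matrix.rank_diagonal]
    have : ∀ i : Fin (m + 1), (Function.update 1 0 0 : Fin (m + 1) → K) i ≠ 0 ↔ i ≠ 0 := by
      intro i
      by_cases hi : i = 0 <;> simp [hi]
    simp [this, Fintype.card_subtype_compl]
  · rw [adjugate_congr h1, adjugate_diagonal_update, mul_vecMulVec_mul_transpose, h3]

/-- The permutation matrix of a transposition. -/
def swapMatrix (K : Type*) [Field K] {m : ℕ} (a b : Fin m) : Matrix (Fin m) (Fin m) K :=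
  (Equiv.swap a b).permMatrix K

theorem swapMatrix_apply {m : ℕ} (a b i j : Fin m) :
    swapMatrix K a b i j = if Equiv.swap a b i = j then 1 else 0 := by
  simp [swapMatrix, Equiv.Perm.permMatrix, PEquiv.toMatrix_apply, eq_comm]

theorem swapMatrix_mul_self {m : ℕ} (a b : Fin m) : swapMatrix K a b * swapMatrix K a b = 1 := by
  rw [swapMatrix, ← Matrix.permMatrix_mul, Equiv.swap_mul_self, Matrix.permMatrix_one]

theorem isSymm_swapMatrix {m : ℕ} (a b : Fin m) : (swapMatrix K a b).IsSymm := by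
  rw [Matrix.IsSymm, swapMatrix, Matrix.transpose_permMatrix, Equiv.swap_inv]

/-- Every line but the line spanned by the first basis vector is the kernel of a symmetric matrix
of corank one whose first entry is zero. -/
theorem exists_isSymm_adjugate_of_apply_zero {m : ℕ} {w : Fin (m + 3) → K}
    (hw : LinearIndependent K ![Pi.single 0 1, w]) :
    ∃ S : Matrix (Fin (m + 3)) (Fin (m + 3)) K, S.IsSymm ∧ S 0 0 = 0 ∧ S.det = 0 ∧
      ∃ c : K, c ≠ 0 ∧ S.adjugate = c • Matrix.vecMulVec w w := by
  classical
  obtain ⟨P, Q, h1, h2, h3⟩ := exists_mul_eq_one_of_linearIndependent _ hw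
    (by omega : 2 ≤ m + 3)
  have hP0 : ∀ j, P j 0 = (Pi.single 0 1 : Fin (m + 3) → K) j := fun j => h3 0 j
  have hP1 : P.mulVec (Pi.single 1 1) = w := by
    ext j
    rw [Matrix.mulVec_single_one]
    exact h3 1 j
  -- `P` fixes `e₀`, hence so does its inverse; congruence by `Q` then preserves the corner entry.
  have hQ0 : ∀ j, Q j 0 = (Pi.single 0 1 : Fin (m + 3) → K) j := by
    intro j
    have := congrFun (congrFun h2 j) 0
    simp only [Matrix.mul_apply, hP0, Pi.single_apply, mul_ite, mul_one, mul_zero,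
      Finset.sum_ite_eq', Finset.mem_univ, if_true] at this
    rw [this, Matrix.one_apply, Pi.single_apply]
  have h02 : (0 : Fin (m + 3)) ≠ 2 := by simp [Fin.ext_iff, Nat.mod_eq_of_lt]
  have h12 : (1 : Fin (m + 3)) ≠ 2 := by simp [Fin.ext_iff, Nat.mod_eq_of_lt]
  -- `D` exchanges `e₀` and `e₂`, kills `e₁` and fixes the other basis vectors: its corner is zero
  -- and its kernel is the line of `e₁`. The third basis vector is what makes this possible.
  let D : Matrix (Fin (m + 3)) (Fin (m + 3)) K :=
    swapMatrix K 0 2 * Matrix.diagonal (Function.update 1 1 0)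
  have hs1 : Equiv.swap (0 : Fin (m + 3)) 2 1 = 1 :=
    Equiv.swap_apply_of_ne_of_ne (by simp) h12
  have hD : ∀ i j, D i j = if Equiv.swap 0 2 i = j then (if j = 1 then 0 else 1) else 0 := by
    intro i j
    simp only [D, Matrix.mul_diagonal, swapMatrix_apply, Function.update_apply, Pi.one_apply]
    split_ifs <;> simp
  have hDs : D.IsSymm := by
    ext i j
    rw [Matrix.transpose_apply, hD, hD]
    by_cases h : Equiv.swap 0 2 j = i
    · subst h
      rw [Equiv.swap_apply_self, if_pos rfl, if_pos rfl]
      by_cases hj : j = 1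
      · subst hj
        simp [hs1]
      · rw [if_neg hj, if_neg fun h => hj ?_]
        rw [← Equiv.swap_apply_self 0 2 j, h, hs1]
    · rw [if_neg h, if_neg fun h' => h ?_]
      rw [← h', Equiv.swap_apply_self]
  have hD0 : D 0 0 = 0 := by
    rw [hD, Equiv.swap_apply_left, if_neg (Ne.symm h02)]
  have hadj : ∃ c : K, c ≠ 0 ∧ D.adjugate = c • Matrix.vecMulVec (Pi.single 1 1) (Pi.single 1 1) := by
    have hdet := det_ne_zero_of_mul_eq_one (swapMatrix_mul_self (K := K) (0 : Fin (m + 3)) 2)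
    refine ⟨(swapMatrix K (0 : Fin (m + 3)) 2).det, hdet, ?_⟩
    rw [Matrix.adjugate_mul_distrib, adjugate_diagonal_update,
      adjugate_eq_det_smul (swapMatrix_mul_self (K := K) (0 : Fin (m + 3)) 2), Matrix.mul_smul,
      Matrix.vecMulVec_mul]
    congr 2
    ext j
    simp [swapMatrix_apply, hs1, Pi.single_apply, eq_comm]
  obtain ⟨c, hc, hadj⟩ := hadj
  refine ⟨Q.transpose * D * Q, isSymm_congr hDs _, ?_, ?_, Q.det ^ 2 * c,
    mul_ne_zero (pow_ne_zero 2 (det_ne_zero_of_mul_eq_one h1)) hc, ?_⟩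
  · simp [Matrix.mul_apply, hQ0, Pi.single_apply, hD0]
  · rw [Matrix.det_mul, Matrix.det_mul, Matrix.det_mul, Matrix.det_diagonal,
      Finset.prod_eq_zero (Finset.mem_univ 1) (by simp)]
    ring
  · rw [adjugate_congr h1, hadj, Matrix.mul_smul, Matrix.smul_mul, mul_vecMulVec_mul_transpose, hP1,
      smul_smul]

end Singular

/-! ### Arrow matrices and irreducibility of determinants. -/

section Arrow

open MvPolynomial

variable {K : Type*} [Field K] {k : ℕ}

/-- The matrix with first row and column `(c, a)` and diagonal `(c, d)`, whose other entries
vanish. -/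
def arrowMatrix (c : K) (a d : Fin k → K) : Matrix (Fin (k + 1)) (Fin (k + 1)) K :=
  Matrix.of (Fin.cons (Fin.cons c a) fun i => Fin.cons (a i) fun j => Matrix.diagonal d i j)

theorem isSymm_arrowMatrix (c : K) (a d : Fin k → K) : (arrowMatrix c a d).IsSymm := by
  ext i j
  refine Fin.cases ?_ (fun i => ?_) i <;> refine Fin.cases ?_ (fun j => ?_) j <;>
    simp [arrowMatrix, Matrix.diagonal_apply]
  split_ifs <;> simp_all

/-- This is the Schur complement `c - ∑ aᵢ² / dᵢ` of the diagonal block, times `∏ dᵢ`. -/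
theorem det_arrowMatrix (c : K) (a d : Fin k → K) (hd : ∀ i, d i ≠ 0) :
    (arrowMatrix c a d).det =
      c * ∏ i, d i - ∑ i, a i ^ 2 * ∏ j ∈ Finset.univ.erase i, d j := by
  have : Invertible (Matrix.diagonal d) := Matrix.invertibleOfIsUnitDet _ (by
    rw [Matrix.det_diagonal]
    exact (Finset.prod_ne_zero_iff.2 fun i _ => hd i).isUnit)
  have hinv : ⅟(Matrix.diagonal d) = Matrix.diagonal fun i => (d i)⁻¹ := by
    refine invOf_eq_right_inv ?_
    rw [Matrix.diagonal_mul_diagonal, ← Matrix.diagonal_one]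
    congr 1
    ext i
    exact mul_inv_cancel₀ (hd i)
  have h1 : (arrowMatrix c a d).submatrix (finSumFinEquiv.trans (finCongr (add_comm 1 k)))
      (finSumFinEquiv.trans (finCongr (add_comm 1 k))) =
      Matrix.fromBlocks (Matrix.of fun _ _ : Fin 1 => c) (Matrix.of fun _ j => a j)
        (Matrix.of fun i _ => a i) (Matrix.diagonal d) := by
    have e1 : ∀ i : Fin 1, (finSumFinEquiv.trans (finCongr (add_comm 1 k))) (Sum.inl i) = 0 := by
      intro i
      ext
      simp
    have e2 : ∀ i : Fin k, (finSumFinEquiv.trans (finCongr (add_comm 1 k))) (Sum.inr i) =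
        i.succ := by
      intro i
      ext
      simp
    ext i j
    rcases i with i | i <;> rcases j with j | j <;>
      simp only [Matrix.submatrix_apply, e1, e2] <;> simp [arrowMatrix]
  rw [← Matrix.det_submatrix_equiv_self (finSumFinEquiv.trans (finCongr (add_comm 1 k))), h1,
    Matrix.det_fromBlocks₂₂, hinv, Matrix.det_diagonal, Matrix.det_fin_one, Matrix.sub_apply, mul_sub,
    mul_comm]
  congr 1
  rw [Matrix.mul_apply, Finset.mul_sum]
  simp only [Matrix.mul_diagonal, Matrix.of_apply]
  refine Finset.sum_congr rfl fun i _ => ?_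
  rw [← Finset.mul_prod_erase _ _ (Finset.mem_univ i)]
  field_simp [hd i]

theorem isRelPrime_X {σ : Type*} {A : MvPolynomial σ K} (t : σ) (x : σ → K) (hx : x t = 0)
    (hA : eval x A ≠ 0) : IsRelPrime A (X t) := by
  refine ((Irreducible.isRelPrime_iff_not_dvd (X_prime (R := K)).irreducible).2 ?_).symm
  rintro ⟨B, rfl⟩
  exact hA (by simp [hx])

theorem notMem_vars_of_mem_supported {σ : Type*} {A : MvPolynomial σ K} {t : σ}
    (h : A ∈ supported K ({t}ᶜ : Set σ)) : t ∉ A.vars := fun ht =>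
  mem_supported.1 h (Finset.mem_coe.2 ht) rfl

/-- The variables are the corner, the border and the diagonal of an arrow matrix. This is the
polynomial `∑ aᵢ² ∏_{j ≠ i} dⱼ`, where `i` and `j` run over `s`. -/
def borderPoly (K : Type*) [Field K] {k : ℕ} (s : Finset (Fin k)) :
    MvPolynomial (Option (Fin k ⊕ Fin k)) K :=
  ∑ i ∈ s, X (some (Sum.inl i)) ^ 2 * ∏ j ∈ s.erase i, X (some (Sum.inr j))

/-- The coordinates of the arrow matrix with corner zero, border `a` and diagonal `d`. -/
def arrowPoint (a d : Fin k → K) : Option (Fin k ⊕ Fin k) → K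
  | none => 0
  | some (Sum.inl i) => a i
  | some (Sum.inr i) => d i

theorem eval_arrowPoint_borderPoly (s : Finset (Fin k)) (a d : Fin k → K) :
    eval (arrowPoint a d) (borderPoly K s) = ∑ i ∈ s, a i ^ 2 * ∏ j ∈ s.erase i, d j := by
  simp [borderPoly, arrowPoint]

theorem isRelPrime_borderPoly (s : Finset (Fin k)) (j i : Fin k) (hi : i ∈ s)
    (hij : j ∈ s → i = j) : IsRelPrime (borderPoly K s) (X (some (Sum.inr j))) := by
  -- At this point `dⱼ = 0` and the only surviving summand is the one of index `i`. Its product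
  -- omits `dⱼ`, since either `j = i` or `j ∉ s`.
  refine isRelPrime_X _ (arrowPoint (Pi.single i 1) (Function.update 1 j 0))
    (Function.update_self j 0 1) ?_
  rw [eval_arrowPoint_borderPoly, Finset.sum_eq_single i]
  · rw [Finset.prod_eq_one]
    · simp
    · intro l hl
      have : l ≠ j := by
        rintro rfl
        exact Finset.ne_of_mem_erase hl (hij (Finset.mem_of_mem_erase hl)).symm
      simp [this]
  · intro l _ hl
    simp [hl]
  · exact fun h => absurd hi h

/-- The polynomial has degree one in `d₀`, with coefficients coprime and free of `d₀`. With a single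
border entry it would be the square `a₀²`, hence the bound on `k`. -/
theorem irreducible_borderPoly (hk : 2 ≤ k) :
    Irreducible (borderPoly K (Finset.univ : Finset (Fin k))) := by
  obtain ⟨k, rfl⟩ := Nat.exists_eq_add_of_le' hk
  have hdec : borderPoly K (Finset.univ : Finset (Fin (k + 2))) =
      borderPoly K (Finset.univ.erase 0) * X (some (Sum.inr 0)) +
        X (some (Sum.inl 0)) ^ 2 * ∏ j ∈ Finset.univ.erase 0, X (some (Sum.inr j)) := by
    rw [borderPoly, ← Finset.add_sum_erase _ _ (Finset.mem_univ 0), add_comm (_ ^ 2 * _), borderPoly,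
      Finset.sum_mul, add_left_inj]
    refine Finset.sum_congr rfl fun i hi => ?_
    rw [Finset.erase_right_comm, mul_assoc, Finset.prod_erase_mul]
    exact Finset.mem_erase.2 ⟨(Finset.ne_of_mem_erase hi).symm, Finset.mem_univ _⟩
  have h1 : (1 : Fin (k + 2)) ∈ Finset.univ.erase 0 := by simp
  rw [hdec]
  refine irreducible_mul_X_add _ _ _ ?_ ?_ ?_ ?_
  · intro h0
    have := isRelPrime_borderPoly (K := K) (Finset.univ.erase 0) 1 1 h1 fun _ => rfl
    rw [h0, isRelPrime_zero_left] at this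
    exact (X_prime (R := K)).not_isUnit this
  · refine notMem_vars_of_mem_supported (sum_mem fun i hi => mul_mem (pow_mem ?_ _)
      (prod_mem fun j hj => ?_))
    · exact X_mem_supported.2 (by simp)
    · have := Finset.ne_of_mem_erase (Finset.mem_of_mem_erase hj)
      exact X_mem_supported.2 (by simpa using this)
  · refine notMem_vars_of_mem_supported (mul_mem (pow_mem ?_ _) (prod_mem fun j hj => ?_))
    · exact X_mem_supported.2 (by simp)
    · have := Finset.ne_of_mem_erase hj
      exact X_mem_supported.2 (by simpa using this)
  · refine IsRelPrime.mul_right (IsRelPrime.pow_right ?_) (IsRelPrime.prod_right fun j hj => ?_)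
    · refine isRelPrime_X _ (arrowPoint (Pi.single 1 1) 1) (by simp [arrowPoint]) ?_
      rw [eval_arrowPoint_borderPoly, Finset.sum_eq_single 1]
      · simp
      · intro l _ hl
        simp [hl]
      · exact fun h => absurd h1 h
    · exact isRelPrime_borderPoly _ j j hj fun _ => rfl

/-- The determinant of the generic arrow matrix. -/
def arrowPoly (K : Type*) [Field K] (k : ℕ) : MvPolynomial (Option (Fin k ⊕ Fin k)) K :=
  (∏ j, X (some (Sum.inr j))) * X none - borderPoly K Finset.univ

/-- The polynomial has degree one in the corner variable. The leading coefficient is the product of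
the `dⱼ`, none of which divides the border polynomial. -/
theorem irreducible_arrowPoly : Irreducible (arrowPoly K k) := by
  rw [arrowPoly, sub_eq_add_neg]
  refine irreducible_mul_X_add _ _ _ ?_ ?_ ?_ ?_
  · exact Finset.prod_ne_zero_iff.2 fun j _ => X_ne_zero _
  · exact notMem_vars_of_mem_supported (prod_mem fun j _ => X_mem_supported.2 (by simp))
  · rw [vars_neg]
    exact notMem_vars_of_mem_supported (sum_mem fun i hi => mul_mem
      (pow_mem (X_mem_supported.2 (by simp)) _)
      (prod_mem fun j hj => X_mem_supported.2 (by simp)))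
  · refine IsRelPrime.neg_right (IsRelPrime.prod_left fun j _ => ?_)
    exact (isRelPrime_borderPoly _ j j (Finset.mem_univ j) fun _ => rfl).symm

theorem isHomogeneous_borderPoly :
    (borderPoly K (Finset.univ : Finset (Fin (k + 1)))).IsHomogeneous (k + 2) := by
  refine IsHomogeneous.sum _ _ _ fun i _ => ?_
  have h1 := (isHomogeneous_X K (some (Sum.inl i) : Option (Fin (k + 1) ⊕ Fin (k + 1)))).pow 2
  have h2 := IsHomogeneous.prod (Finset.univ.erase i)
    (fun j => (X (some (Sum.inr j)) : MvPolynomial (Option (Fin (k + 1) ⊕ Fin (k + 1))) K))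
    (fun _ => 1) fun j _ => isHomogeneous_X _ _
  have h3 := h1.mul h2
  have h4 : 1 * 2 + ∑ _i ∈ (Finset.univ : Finset (Fin (k + 1))).erase i, 1 = k + 2 := by
    simp
    ring
  rwa [h4] at h3

theorem isHomogeneous_arrowPoly : (arrowPoly K (k + 1)).IsHomogeneous (k + 2) := by
  refine IsHomogeneous.sub ?_ isHomogeneous_borderPoly
  have h2 := (IsHomogeneous.prod Finset.univ
    (fun j => (X (some (Sum.inr j)) : MvPolynomial (Option (Fin (k + 1) ⊕ Fin (k + 1))) K))
    (fun _ => 1) fun j _ => isHomogeneous_X _ _).mul (isHomogeneous_X K none)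
  simpa using h2

theorem eval_arrowPoly (x : Option (Fin k ⊕ Fin k) → K) (hx : ∀ i, x (some (Sum.inr i)) ≠ 0) :
    eval x (arrowPoly K k) = (arrowMatrix (x none) (fun i => x (some (Sum.inl i)))
      fun i => x (some (Sum.inr i))).det := by
  rw [det_arrowMatrix _ _ _ hx]
  simp [arrowPoly, borderPoly, mul_comm]

theorem eval_borderPoly (x : Option (Fin k ⊕ Fin k) → K) (hx : ∀ i, x (some (Sum.inr i)) ≠ 0) :
    eval x (borderPoly K Finset.univ) = -(arrowMatrix 0 (fun i => x (some (Sum.inl i)))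
      fun i => x (some (Sum.inr i))).det := by
  rw [det_arrowMatrix _ _ _ hx]
  simp [borderPoly]

/-- Two polynomials in the entries of an arrow matrix agree if they agree at invertible
diagonals. -/
theorem eq_of_eval_eq_of_diagonal_ne_zero [Infinite K]
    {F G : MvPolynomial (Option (Fin k ⊕ Fin k)) K}
    (h : ∀ x : Option (Fin k ⊕ Fin k) → K, (∀ i, x (some (Sum.inr i)) ≠ 0) →
      eval x F = eval x G) : F = G := by
  have hne : (∏ j : Fin k, X (some (Sum.inr j)) : MvPolynomial (Option (Fin k ⊕ Fin k)) K) ≠ 0 :=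
    Finset.prod_ne_zero_iff.2 fun j _ => X_ne_zero _
  refine mul_left_cancel₀ hne (MvPolynomial.funext fun x => ?_)
  rw [map_mul, map_mul, map_prod]
  simp only [eval_X]
  by_cases hx : ∀ i, x (some (Sum.inr i)) ≠ 0
  · rw [h x hx]
  · push Not at hx
    obtain ⟨i, hi⟩ := hx
    rw [Finset.prod_eq_zero (Finset.mem_univ i) hi, zero_mul, zero_mul]

/-- The linear family of arrow matrices, with the corner multiplied by `c`. -/
def arrowFamily (K : Type*) [Field K] (k : ℕ) (c : K) :
    (Option (Fin k ⊕ Fin k) → K) →ₗ[K] Matrix (Fin (k + 1)) (Fin (k + 1)) K where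
  toFun x := arrowMatrix (c * x none) (fun i => x (some (Sum.inl i)))
    fun i => x (some (Sum.inr i))
  map_add' x y := by
    ext i j
    refine Fin.cases ?_ (fun i => ?_) i <;> refine Fin.cases ?_ (fun j => ?_) j <;>
      simp [arrowMatrix, Matrix.diagonal_apply, mul_add]
    split_ifs <;> simp
  map_smul' a x := by
    ext i j
    refine Fin.cases ?_ (fun i => ?_) i <;> refine Fin.cases ?_ (fun j => ?_) j <;>
      simp [arrowMatrix, Matrix.diagonal_apply, mul_left_comm]

/-- A form is irreducible if its restriction to a linear family is the determinant of a generic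
arrow matrix. -/
theorem irreducible_of_arrowFamily [Infinite K] {σ : Type*} {F : MvPolynomial σ K}
    (hF : F.IsHomogeneous (k + 2)) (L : (Option (Fin (k + 1) ⊕ Fin (k + 1)) → K) →ₗ[K] (σ → K))
    {c : K} (hc : c = 0 ∧ 1 ≤ k ∨ c = 1) {e : K} (he : e ≠ 0)
    (h : ∀ x, eval (L x) F = e * (arrowFamily K (k + 1) c x).det) : Irreducible F := by
  have main : ∀ (P : MvPolynomial (Option (Fin (k + 1) ⊕ Fin (k + 1))) K) (u : K), u ≠ 0 →
      Irreducible P → P.IsHomogeneous (k + 2) → (∀ x : Option (Fin (k + 1) ⊕ Fin (k + 1)) → K,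
      (∀ i, x (some (Sum.inr i)) ≠ 0) → eval (L x) F = u * eval x P) → Irreducible F := by
    intro P u hu hirr hhom hev
    have heq : aeval (linSubst L) F = C u * P := eq_of_eval_eq_of_diagonal_ne_zero fun x hx => by
      rw [eval_aeval_linSubst, hev x hx, map_mul, eval_C]
    have hunit : IsUnit (C u : MvPolynomial (Option (Fin (k + 1) ⊕ Fin (k + 1))) K) :=
      hu.isUnit.map C
    have hirr' : Irreducible (C u * P) := (irreducible_isUnit_mul hunit).2 hirr
    refine irreducible_of_irreducible_aeval (linSubst L)
      (fun s => (isHomogeneous_linSubst L s).totalDegree_le) F ?_ (heq ▸ hirr')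
    -- The pulled back form is nonzero of degree `k + 2`, so the substitution has not lowered the
    -- degree.
    rw [heq, (hhom.C_mul u).totalDegree hirr'.ne_zero]
    exact hF.totalDegree_le
  rcases hc with ⟨rfl, hk⟩ | rfl
  · refine main _ (-e) (neg_ne_zero.2 he) (irreducible_borderPoly (by omega))
      isHomogeneous_borderPoly fun x hx => ?_
    rw [h, eval_borderPoly x hx, neg_mul_neg]
    simp [arrowFamily]
  · refine main _ e he irreducible_arrowPoly isHomogeneous_arrowPoly fun x hx => ?_
    rw [h, eval_arrowPoly x hx]
    simp [arrowFamily]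

end Arrow

end PolarGeometry

end

noncomputable section

namespace PolarGeometry

/-! ### The Veronese variety, its tangent spaces and its dual. -/

section Veronese

open MvPolynomial Matrix

variable {K : Type*} [Field K] {m : ℕ}

/-- The quadratic forms that parametrize the Veronese variety. -/
def veronesePoly (K : Type*) [Field K] (m : ℕ) (s : Sym2 (Fin m)) : MvPolynomial (Fin m) K :=
  Sym2.lift ⟨fun i j => X i * X j, fun _ _ => mul_comm _ _⟩ s

theorem veronesePoly_mk (i j : Fin m) : veronesePoly K m s(i, j) = X i * X j := rfl

theorem symMatrix_eval_veronesePoly (w : Fin m → K) :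
    symMatrix (fun s => eval w (veronesePoly K m s)) = vecMulVec w w := by
  ext i j
  simp [veronesePoly_mk, vecMulVec_apply]

theorem eval_aeval_veronesePoly (w : Fin m → K) (F : MvPolynomial (Sym2 (Fin m)) K) :
    eval w (aeval (veronesePoly K m) F) = eval (fun s => eval w (veronesePoly K m s)) F := by
  rw [← aeval_eq_eval, ← AlgHom.comp_apply, comp_aeval, aeval_eq_eval]

theorem eval_veronesePoly_ne_zero {w : Fin m → K} (hw : w ≠ 0) :
    (fun s => eval w (veronesePoly K m s)) ≠ 0 := by
  intro h
  obtain ⟨i, hi⟩ := Function.ne_iff.1 hw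
  have := congrFun h s(i, i)
  simp only [veronesePoly_mk, map_mul, eval_X, Pi.zero_apply, mul_self_eq_zero] at this
  exact hi this

theorem exists_mem_veronese [IsAlgClosed K] {w : Fin m → K} (hw : w ≠ 0) :
    ∃ x ∈ veronese K m, ∃ t : K, t ≠ 0 ∧ symMatrix x.rep = vecMulVec (t • w) (t • w) := by
  have h0 := eval_veronesePoly_ne_zero hw
  refine ⟨Projectivization.mk K _ h0, ⟨_, ⟨w, hw, symMatrix_eval_veronesePoly w⟩, h0, rfl⟩, ?_⟩
  obtain ⟨a, ha, hrep⟩ := exists_rep_mk_eq_smul _ h0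
  obtain ⟨t, ht⟩ := IsAlgClosed.exists_pow_nat_eq a (n := 2) (by norm_num)
  refine ⟨t, fun h => ha (by rw [← ht, h]; ring), ?_⟩
  rw [hrep, symMatrix_smul, symMatrix_eval_veronesePoly, smul_vecMulVec, vecMulVec_smul, smul_smul,
    ← sq, ht]

theorem exists_of_mem_veronese [IsAlgClosed K] {x : ℙ K (Sym2 (Fin m) → K)}
    (hx : x ∈ veronese K m) : ∃ w : Fin m → K, w ≠ 0 ∧ symMatrix x.rep = vecMulVec w w := by
  obtain ⟨y, ⟨w, hw, hy⟩, hy0, rfl⟩ := hx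
  obtain ⟨a, ha, hrep⟩ := exists_rep_mk_eq_smul _ hy0
  obtain ⟨t, ht⟩ := IsAlgClosed.exists_pow_nat_eq a (n := 2) (by norm_num)
  have ht0 : t ≠ 0 := fun h => ha (by rw [← ht, h]; ring)
  refine ⟨t • w, smul_ne_zero ht0 hw, ?_⟩
  rw [hrep, symMatrix_smul, hy, smul_vecMulVec, vecMulVec_smul, smul_smul, ← sq, ht]

theorem aeval_veronesePoly_eq_zero [Infinite K] [NeZero m] {F : MvPolynomial (Sym2 (Fin m)) K}
    (hF : F ∈ homIdeal (veronese K m)) : aeval (veronesePoly K m) F = 0 := by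
  -- The factor `X 0` takes care of `w = 0`, which gives no point of projective space.
  refine mul_left_cancel₀ (X_ne_zero (0 : Fin m)) (MvPolynomial.funext fun w => ?_)
  rw [mul_zero, map_zero, map_mul, eval_aeval_veronesePoly]
  by_cases hw : w = 0
  · simp [hw]
  · have h0 := eval_veronesePoly_ne_zero hw
    rw [mem_homIdeal.1 hF _ ⟨h0, _, ⟨w, hw, symMatrix_eval_veronesePoly w⟩, h0, rfl⟩, mul_zero]

/-- The parametrization of the tangent space of the Veronese variety at `w wᵗ`. -/
def veroneseTangent (w : Fin m → K) : (Fin m → K) →ₗ[K] (Sym2 (Fin m) → K) :=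
  symCoords K m ∘ₗ
    { toFun := fun z => vecMulVec z w + vecMulVec w z
      map_add' := fun z z' => by rw [add_vecMulVec, vecMulVec_add]; abel
      map_smul' := fun c z => by
        rw [smul_vecMulVec, vecMulVec_smul, smul_add, RingHom.id_apply] }

theorem veroneseTangent_mk [CharZero K] (w z : Fin m → K) (i j : Fin m) :
    veroneseTangent w z s(i, j) = z i * w j + w i * z j := by
  simp only [veroneseTangent, LinearMap.coe_comp, Function.comp_apply, symCoords_mk,
    LinearMap.coe_mk, AddHom.coe_mk, Matrix.add_apply, vecMulVec_apply]
  ring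

theorem veroneseTangent_injective [CharZero K] {w : Fin m → K} (hw : w ≠ 0) :
    Function.Injective (veroneseTangent w) := by
  rw [injective_iff_map_eq_zero]
  intro z hz
  obtain ⟨k, hk⟩ := Function.ne_iff.1 hw
  have h1 : ∀ i, z i * w k + w i * z k = 0 := fun i => by
    rw [← veroneseTangent_mk, hz, Pi.zero_apply]
  have hk' : w k ≠ 0 := hk
  have h2 : z k = 0 := by
    have h3 : z k * (2 * w k) = 0 := by linear_combination h1 k
    simpa [hk'] using h3
  ext i
  have h3 := h1 i
  rw [h2, mul_zero, add_zero] at h3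
  simpa [hk'] using h3

theorem mem_tangentSpace {ι : Type*} [Fintype ι] {X : Set (ℙ K (ι → K))} {x : ℙ K (ι → K)}
    {u : ι → K} : u ∈ tangentSpace X x ↔ ∀ F ∈ homIdeal X, ∑ i, gradient F x.rep i * u i = 0 := by
  simp [tangentSpace, tangentHyperplane, Submodule.mem_iInf]

theorem minor_mem_homIdeal (i j k l : Fin m) :
    (X s(i, j) * X s(k, l) - X s(i, l) * X s(k, j) : MvPolynomial (Sym2 (Fin m)) K) ∈
      homIdeal (veronese K m) := by
  rw [mem_homIdeal]
  rintro v ⟨hv, y, ⟨w, hw, hy⟩, hy0, h⟩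
  obtain ⟨c, rfl⟩ := (Projectivization.mk_eq_mk_iff' K _ _ hv hy0).1 h
  have h1 : ∀ a b, y s(a, b) = w a * w b := fun a b => congrFun (congrFun hy a) b
  simp only [map_sub, map_mul, eval_X, Pi.smul_apply, smul_eq_mul, h1]
  ring

/-- The differentials of the two by two minors at `wwᵗ` leave only the vectors `zwᵗ + wzᵗ`. These
are tangent because differentiating `F(wwᵗ) = 0` in `w` annihilates them for every `F` in the ideal.
-/
theorem tangentSpace_veronese [CharZero K] [NeZero m] {x : ℙ K (Sym2 (Fin m) → K)}
    {w : Fin m → K} (hw : w ≠ 0) (hx : symMatrix x.rep = vecMulVec w w) :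
    tangentSpace (veronese K m) x = LinearMap.range (veroneseTangent w) := by
  have hxw : ∀ i j, x.rep s(i, j) = w i * w j := fun i j => congrFun (congrFun hx i) j
  ext u
  rw [mem_tangentSpace]
  constructor
  · intro h
    obtain ⟨a, ha⟩ := Function.ne_iff.1 hw
    have ha' : w a ≠ 0 := ha
    have h1 : ∀ k l, w a * w a * u s(k, l) + w k * w l * u s(a, a) - w a * w l * u s(k, a) -
        w k * w a * u s(a, l) = 0 := by
      intro k l
      have h2 := h _ (minor_mem_homIdeal a a k l)
      simp only [gradient, map_sub, Derivation.leibniz, pderiv_X, smul_eq_mul, map_add, map_mul,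
        eval_X, hxw, add_mul, sub_mul, Finset.sum_add_distrib, Finset.sum_sub_distrib] at h2
      simp only [Pi.single_apply, apply_ite (eval x.rep), map_one, map_zero, mul_ite, ite_mul,
        mul_one, mul_zero, zero_mul, Finset.sum_ite_eq, Finset.mem_univ,
        if_true] at h2
      linear_combination h2
    -- This solves column `a` of `zwᵗ + wzᵗ = u`: the diagonal entry gives `zₐ = uₐₐ / (2wₐ)`, and
    -- the others give `zₖ`. The minors through `(a, a)` then yield the remaining entries.
    refine ⟨fun k => u s(k, a) / w a - u s(a, a) * w k / (2 * w a ^ 2), ?_⟩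
    ext s
    induction s with
    | _ k l =>
      have h2 := h1 k l
      rw [veroneseTangent_mk]
      have h3 : u s(a, l) = u s(l, a) := by rw [Sym2.eq_swap]
      rw [h3] at h2
      field_simp
      linear_combination (-2) * h2
  · rintro ⟨z, rfl⟩ F hF
    have h1 := aeval_veronesePoly_eq_zero hF
    have hrep : (fun s => eval w (veronesePoly K m s)) = x.rep :=
      symMatrix_injective (by rw [symMatrix_eval_veronesePoly, hx])
    have h2 : ∀ i, ∑ s, gradient F x.rep s * eval w (pderiv i (veronesePoly K m s)) = 0 := by
      intro i
      have h3 := pderiv_aeval (veronesePoly K m) F i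
      rw [h1, map_zero] at h3
      have h4 := congrArg (eval w) h3
      rw [map_zero, map_sum] at h4
      rw [h4]
      refine Finset.sum_congr rfl fun s _ => ?_
      rw [map_mul, eval_aeval_veronesePoly, hrep, gradient]
    have h3 : ∀ s, veroneseTangent w z s =
        ∑ i, z i * eval w (pderiv i (veronesePoly K m s)) := by
      intro s
      induction s with
      | _ a b =>
        simp only [veroneseTangent_mk, veronesePoly_mk, Derivation.leibniz, pderiv_X, smul_eq_mul,
          map_add, eval_X, mul_add, Finset.sum_add_distrib, Pi.single_apply,
          apply_ite (eval w), map_zero, mul_ite, mul_one, mul_zero,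
          Finset.sum_ite_eq, Finset.mem_univ, if_true]
        ring
    simp only [h3, Finset.mul_sum]
    rw [Finset.sum_comm]
    refine Finset.sum_eq_zero fun i _ => ?_
    have h4 := congrArg (z i * ·) (h2 i)
    simp only [Finset.mul_sum, mul_zero] at h4
    rw [← h4]
    exact Finset.sum_congr rfl fun s _ => by ring

/-- All tangent spaces have the same dimension, since `z ↦ zwᵗ + wzᵗ` is injective for `w ≠ 0`. -/
theorem isSmoothPoint_veronese [IsAlgClosed K] [CharZero K] [NeZero m]
    {x : ℙ K (Sym2 (Fin m) → K)} (hx : x ∈ veronese K m) : IsSmoothPoint (veronese K m) x := by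
  have h : ∀ z ∈ veronese K m, Module.finrank K (tangentSpace (veronese K m) z) = m := by
    intro z hz
    obtain ⟨w, hw, hzw⟩ := exists_of_mem_veronese hz
    rw [tangentSpace_veronese hw hzw, LinearMap.finrank_range_of_inj (veroneseTangent_injective hw),
      Module.finrank_fin_fun]
  exact ⟨hx, fun z hz => by rw [h x hx, h z hz]⟩

/-- The equation of the dual of the Veronese variety. -/
def dualDet (K : Type*) [Field K] (m : ℕ) : MvPolynomial (Sym2 (Fin m)) K :=
  aeval (linSubst (halfOff K m)) (symDet K m)

theorem eval_dualDet (z : Sym2 (Fin m) → K) :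
    eval z (dualDet K m) = (symMatrix (halfOff K m z)).det := by
  rw [dualDet, eval_aeval_linSubst, eval_symDet]

theorem isHomogeneous_dualDet : (dualDet K m).IsHomogeneous m :=
  isHomogeneous_aeval_linSubst _ isHomogeneous_symDet

theorem dotProduct_veroneseTangent [CharZero K] (y : Sym2 (Fin m) → K) (w z : Fin m → K) :
    y ⬝ᵥ veroneseTangent w z = 2 * (z ⬝ᵥ symMatrix (halfOff K m y) *ᵥ w) := by
  rw [dotProduct, ← trace_symMatrix_halfOff, trace_mul_symMatrix]
  simp only [veroneseTangent_mk, dotProduct, mulVec, Finset.mul_sum, mul_add,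
    Finset.sum_add_distrib, symMatrix_apply]
  have h : ∑ i, ∑ j, halfOff K m y s(i, j) * (w i * z j) =
      ∑ i, ∑ j, halfOff K m y s(i, j) * (z i * w j) := by
    rw [Finset.sum_comm]
    exact Finset.sum_congr rfl fun i _ => Finset.sum_congr rfl fun j _ => by
      rw [Sym2.eq_swap, mul_comm (w j)]
  rw [h, ← two_mul, Finset.mul_sum]
  refine Finset.sum_congr rfl fun i _ => ?_
  rw [Finset.mul_sum]
  exact Finset.sum_congr rfl fun j _ => by ring

/-- The pairing of `Y` with `zwᵗ + wzᵗ` is `2 zᵗYw`, so the hyperplane `Y` is tangent at `wwᵗ`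
exactly when `Yw = 0`. It is tangent somewhere exactly when `det Y = 0`, which is already a closed
condition. -/
theorem dualVariety_veronese [IsAlgClosed K] [CharZero K] [NeZero m] :
    dualVariety (veronese K m) = hypersurface (dualDet K m) := by
  rw [dualVariety, ← zariskiClosure_hypersurface (isHomogeneous_dualDet (K := K) (m := m))]
  congr 1
  ext y
  change _ ↔ eval y.rep (dualDet K m) = 0
  rw [eval_dualDet, ← exists_mulVec_eq_zero_iff]
  have key : ∀ {x : ℙ K (Sym2 (Fin m) → K)} {w : Fin m → K}, w ≠ 0 →
      symMatrix x.rep = vecMulVec w w → ((∀ u ∈ tangentSpace (veronese K m) x, y.rep ⬝ᵥ u = 0) ↔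
        symMatrix (halfOff K m y.rep) *ᵥ w = 0) := by
    intro x w hw hx
    rw [tangentSpace_veronese hw hx]
    simp only [LinearMap.mem_range, forall_exists_index, forall_apply_eq_imp_iff,
      dotProduct_veroneseTangent]
    constructor
    · intro h
      ext i
      simpa using h (Pi.single i 1)
    · intro h z
      rw [h, dotProduct_zero, mul_zero]
  constructor
  · rintro ⟨x, hx, h⟩
    obtain ⟨w, hw, hxw⟩ := exists_of_mem_veronese hx.1
    exact ⟨w, hw, (key hw hxw).1 h⟩
  · rintro ⟨w, hw, h⟩
    obtain ⟨x, hx, t, ht, hxw⟩ := exists_mem_veronese hw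
    exact ⟨x, isSmoothPoint_veronese hx, (key (smul_ne_zero ht hw) hxw).2 (by
      rw [mulVec_smul, h, smul_zero])⟩

end Veronese

end PolarGeometry

end

noncomputable section

namespace PolarGeometry

open MvPolynomial Matrix

/-! ### Directional derivatives. -/

section Directional

variable {K : Type*} [Field K] {σ τ : Type*}

theorem sum_gradient_aeval_linSubst [Fintype σ] [Fintype τ] [DecidableEq τ]
    (L : (τ → K) →ₗ[K] (σ → K)) (F : MvPolynomial σ K) (x u : τ → K) :
    ∑ t, gradient (aeval (linSubst L) F) x t * u t = ∑ s, gradient F (L x) s * L u s := by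
  have h : ∀ s, L u s = ∑ t, u t * L (Pi.single t 1) s := fun s => by
    conv_lhs => rw [pi_eq_sum_univ' u]
    simp only [map_sum, map_smul, Finset.sum_apply, Pi.smul_apply, smul_eq_mul]
  simp only [gradient_aeval_linSubst, h, Finset.mul_sum, Finset.sum_mul]
  rw [Finset.sum_comm]
  exact Finset.sum_congr rfl fun s _ => Finset.sum_congr rfl fun t _ => by ring

theorem gradient_C_mul (c : K) (F : MvPolynomial σ K) (x : σ → K) :
    gradient (C c * F) x = c • gradient F x := by
  ext i
  simp [gradient]

/-- The derivative along a line on which the polynomial vanishes is zero. -/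
theorem sum_gradient_eq_zero_of_line [Infinite K] [Fintype σ] (F : MvPolynomial σ K) (y x : σ → K)
    (h : ∀ s : K, eval (y + s • x) F = 0) : ∑ i, gradient F y i * x i = 0 := by
  let φ : σ → MvPolynomial Unit K := fun i => C (y i) + C (x i) * X ()
  have hev : ∀ (s : Unit → K) (F' : MvPolynomial σ K),
      eval s (aeval φ F') = eval (y + s () • x) F' := by
    intro s F'
    rw [← aeval_eq_eval, ← AlgHom.comp_apply, comp_aeval, aeval_eq_eval]
    congr 2
    ext i
    simp [φ, mul_comm]
  have h0 : aeval φ F = 0 := MvPolynomial.funext fun s => by rw [hev, h, map_zero]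
  have h1 := congrArg (eval 0) (pderiv_aeval φ F ())
  rw [h0, map_zero, map_zero, map_sum] at h1
  rw [h1]
  refine Finset.sum_congr rfl fun i _ => ?_
  rw [map_mul, hev]
  simp [φ, gradient]

end Directional

/-! ### The lower right block, and charts on the symmetric matrices with zero corner. -/

section Low

variable {K : Type*} [Field K] {n : ℕ}

/-- The lower right block of a matrix. -/
def lowerBlock (Y : Matrix (Fin (n + 1)) (Fin (n + 1)) K) : Matrix (Fin n) (Fin n) K :=
  Y.submatrix Fin.succ Fin.succ

theorem det_lowerBlock (Y : Matrix (Fin (n + 1)) (Fin (n + 1)) K) :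
    (lowerBlock Y).det = Y.adjugate 0 0 := by
  rw [adjugate_fin_succ_eq_det_submatrix]
  simp [lowerBlock]

theorem isSymm_lowerBlock {Y : Matrix (Fin (n + 1)) (Fin (n + 1)) K} (hY : Y.IsSymm) :
    (lowerBlock Y).IsSymm := hY.submatrix _

/-- The matrix with a given lower right block, whose first row and column vanish. -/
def extendByZero (K : Type*) [Field K] (n : ℕ) :
    Matrix (Fin n) (Fin n) K →ₗ[K] Matrix (Fin (n + 1)) (Fin (n + 1)) K where
  toFun M := Matrix.of (Fin.cons 0 fun i => Fin.cons 0 (M i))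
  map_add' M N := by
    ext i j
    refine Fin.cases ?_ (fun i => ?_) i <;> refine Fin.cases ?_ (fun j => ?_) j <;> simp
  map_smul' c M := by
    ext i j
    refine Fin.cases ?_ (fun i => ?_) i <;> refine Fin.cases ?_ (fun j => ?_) j <;> simp

@[simp]
theorem extendByZero_zero_left (M : Matrix (Fin n) (Fin n) K) (j : Fin (n + 1)) :
    extendByZero K n M 0 j = 0 := rfl

@[simp]
theorem extendByZero_zero_right (M : Matrix (Fin n) (Fin n) K) (i : Fin (n + 1)) :
    extendByZero K n M i 0 = 0 := by
  refine Fin.cases rfl (fun i => rfl) i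

@[simp]
theorem extendByZero_succ_succ (M : Matrix (Fin n) (Fin n) K) (i j : Fin n) :
    extendByZero K n M i.succ j.succ = M i j := rfl

theorem lowerBlock_extendByZero (M : Matrix (Fin n) (Fin n) K) :
    lowerBlock (extendByZero K n M) = M := rfl

theorem isSymm_extendByZero {M : Matrix (Fin n) (Fin n) K} (hM : M.IsSymm) :
    (extendByZero K n M).IsSymm := by
  ext i j
  refine Fin.cases ?_ (fun i => ?_) i <;> refine Fin.cases ?_ (fun j => ?_) j <;> simp
  exact hM.apply i j

theorem trace_mul_extendByZero (Y : Matrix (Fin (n + 1)) (Fin (n + 1)) K)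
    (M : Matrix (Fin n) (Fin n) K) :
    (Y * extendByZero K n M).trace = (lowerBlock Y * M).trace := by
  simp [Matrix.trace, Matrix.mul_apply, Fin.sum_univ_succ, lowerBlock]

end Low

/-- Linear coordinates on the space of symmetric matrices whose first entry is zero. -/
structure CornerChart (K : Type*) [Field K] (n : ℕ) (ι : Type*) where
  toLin : (ι → K) →ₗ[K] (Sym2 (Fin (n + 1)) → K)
  inv : (Sym2 (Fin (n + 1)) → K) →ₗ[K] (ι → K)
  inv_toLin : ∀ x, inv (toLin x) = x
  toLin_inv : ∀ y, toLin (inv y) = y - Pi.single s(0, 0) (y s(0, 0))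

namespace CornerChart

variable {K : Type*} [Field K] {n : ℕ} {ι : Type*} (E : CornerChart K n ι)

theorem toLin_corner (x : ι → K) : E.toLin x s(0, 0) = 0 := by
  have h := E.toLin_inv (E.toLin x)
  rw [E.inv_toLin, eq_comm, sub_eq_self] at h
  simpa using congrFun h s(0, 0)

theorem toLin_inv_of_corner {y : Sym2 (Fin (n + 1)) → K} (hy : y s(0, 0) = 0) :
    E.toLin (E.inv y) = y := by
  rw [E.toLin_inv, hy, Pi.single_zero, sub_zero]

theorem toLin_injective : Function.Injective E.toLin :=
  Function.LeftInverse.injective E.inv_toLin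

/-- The coordinates of a symmetric matrix whose first entry is zero. -/
def coords (S : Matrix (Fin (n + 1)) (Fin (n + 1)) K) : ι → K := E.inv (symCoords K (n + 1) S)

theorem symMatrix_coords [CharZero K] {S : Matrix (Fin (n + 1)) (Fin (n + 1)) K} (hS : S.IsSymm)
    (h0 : S 0 0 = 0) : symMatrix (E.toLin (E.coords S)) = S := by
  rw [coords, E.toLin_inv_of_corner, symMatrix_symCoords hS]
  simp [symCoords_mk, h0]

section Fintype

variable [Fintype ι] [DecidableEq ι]

/-- The determinant in the coordinates of the chart. -/
def detPoly : MvPolynomial ι K := aeval (linSubst E.toLin) (symDet K (n + 1))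

theorem eval_detPoly (x : ι → K) : eval x E.detPoly = (symMatrix (E.toLin x)).det := by
  rw [detPoly, eval_aeval_linSubst, eval_symDet]

theorem isHomogeneous_detPoly : E.detPoly.IsHomogeneous (n + 1) :=
  isHomogeneous_aeval_linSubst _ isHomogeneous_symDet

/-- The transpose of the chart with respect to the trace form. -/
def dualMap : Matrix (Fin (n + 1)) (Fin (n + 1)) K →ₗ[K] (ι → K) where
  toFun Y i := (Y * symMatrix (E.toLin (Pi.single i 1))).trace
  map_add' Y Z := by
    ext i
    simp [add_mul]
  map_smul' c Y := by
    ext i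
    simp

theorem sum_dualMap (Y : Matrix (Fin (n + 1)) (Fin (n + 1)) K) (x : ι → K) :
    ∑ i, E.dualMap Y i * x i = (Y * symMatrix (E.toLin x)).trace := by
  have h : E.toLin x = ∑ i, x i • E.toLin (Pi.single i 1) := by
    conv_lhs => rw [pi_eq_sum_univ' x]
    simp only [map_sum, map_smul]
  have h2 : symMatrix (E.toLin x) = ∑ i, x i • symMatrix (E.toLin (Pi.single i 1)) := by
    rw [h]
    ext i j
    simp [Matrix.sum_apply]
  rw [h2]
  simp [dualMap, Matrix.mul_sum, Matrix.trace_sum, mul_comm]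

theorem gradient_detPoly (x : ι → K) :
    gradient E.detPoly x = E.dualMap (symMatrix (E.toLin x)).adjugate := by
  ext i
  rw [detPoly, gradient_aeval_linSubst, sum_gradient_symDet]
  rfl

/-- The linear form on the space of symmetric matrices vanishing on the first unit matrix that
restricts to `y`. -/
def functional : (ι → K) →ₗ[K] (Sym2 (Fin (n + 1)) → K) where
  toFun y s := ∑ i, y i * E.inv (Pi.single s 1) i
  map_add' y z := by
    ext s
    simp [add_mul, Finset.sum_add_distrib]
  map_smul' c y := by
    ext s
    simp [Finset.mul_sum, mul_assoc]

theorem sum_functional (y : ι → K) (u : Sym2 (Fin (n + 1)) → K) :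
    ∑ s, E.functional y s * u s = ∑ i, y i * E.inv u i := by
  have h : E.inv u = ∑ s, u s • E.inv (Pi.single s 1) := by
    conv_lhs => rw [pi_eq_sum_univ' u]
    simp only [map_sum, map_smul]
  rw [h]
  simp only [functional, LinearMap.coe_mk, AddHom.coe_mk, Finset.sum_mul, Finset.sum_apply,
    Pi.smul_apply, smul_eq_mul, Finset.mul_sum]
  rw [Finset.sum_comm]
  exact Finset.sum_congr rfl fun i _ => Finset.sum_congr rfl fun s _ => by ring

/-- A linear section of `dualMap`. -/
def dualSection : (ι → K) →ₗ[K] (Sym2 (Fin (n + 1)) → K) := halfOff K (n + 1) ∘ₗ E.functional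

theorem dualMap_dualSection [CharZero K] (y : ι → K) :
    E.dualMap (symMatrix (E.dualSection y)) = y := by
  ext i
  change (symMatrix (halfOff K (n + 1) (E.functional y)) * _).trace = _
  rw [trace_symMatrix_halfOff, sum_functional, inv_toLin]
  simp [Pi.single_apply]

/-- Two symmetric matrices with the same image under `dualMap` differ only in the corner, so a zero
corner singles out the representative. -/
theorem dualSection_dualMap [CharZero K] {Y : Matrix (Fin (n + 1)) (Fin (n + 1)) K} (hY : Y.IsSymm)
    (h0 : Y 0 0 = 0) : symMatrix (E.dualSection (E.dualMap Y)) = Y := by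
  refine symMatrix_eq_of_trace_eq (isSymm_symMatrix _) hY fun u => ?_
  change (symMatrix (halfOff K (n + 1) (E.functional _)) * _).trace = _
  rw [trace_symMatrix_halfOff, sum_functional, sum_dualMap, toLin_inv]
  have h1 : symMatrix (u - Pi.single s(0, 0) (u s(0, 0))) =
      symMatrix u - symMatrix (Pi.single s(0, 0) (u s(0, 0))) := rfl
  rw [h1, mul_sub, trace_sub, sub_eq_self, trace_mul_symMatrix,
    Finset.sum_eq_zero fun i _ => Finset.sum_eq_zero fun j _ => ?_]
  by_cases h : s(i, j) = s(0, 0)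
  · have h2 : i = 0 ∧ j = 0 := by simpa using h
    rw [h2.1, h2.2, h0, zero_mul]
  · rw [Pi.single_eq_of_ne h, mul_zero]

/-- The projection of the dual space to the coordinates of the lower right block. -/
def lowProj : (ι → K) →ₗ[K] (Sym2 (Fin n) → K) where
  toFun y s := ∑ i, y i * E.coords (extendByZero K n (symMatrix (Pi.single s 1))) i
  map_add' y z := by
    ext s
    simp [add_mul, Finset.sum_add_distrib]
  map_smul' c y := by
    ext s
    simp [Finset.mul_sum, mul_assoc]

/-- Extension by zero is the transpose of taking the lower block, and its values have zero corner.
So the block is determined by the class modulo `e₀e₀ᵗ`. -/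
theorem lowProj_dualMap [CharZero K] (Y : Matrix (Fin (n + 1)) (Fin (n + 1)) K) :
    E.lowProj (E.dualMap Y) = traceCoords K n (lowerBlock Y) := by
  ext s
  change ∑ i, E.dualMap Y i * _ = _
  rw [sum_dualMap, E.symMatrix_coords (isSymm_extendByZero (isSymm_symMatrix _)) rfl,
    trace_mul_extendByZero]
  rfl

theorem symMatrix_halfOff_lowProj [CharZero K] {Y : Matrix (Fin (n + 1)) (Fin (n + 1)) K}
    (hY : Y.IsSymm) : symMatrix (halfOff K n (E.lowProj (E.dualMap Y))) = lowerBlock Y := by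
  rw [lowProj_dualMap, symMatrix_halfOff_traceCoords (isSymm_lowerBlock hY)]

theorem lowProj_surjective [CharZero K] : Function.Surjective E.lowProj := fun z =>
  ⟨E.dualMap (extendByZero K n (symMatrix (halfOff K n z))), by
    rw [lowProj_dualMap, lowerBlock_extendByZero, traceCoords_symMatrix_halfOff]⟩

/-- The equation of the polar image. -/
def polarPoly : MvPolynomial ι K := aeval (linSubst E.lowProj) (dualDet K n)

theorem eval_polarPoly (y : ι → K) :
    eval y E.polarPoly = (symMatrix (halfOff K n (E.lowProj y))).det := by
  rw [polarPoly, eval_aeval_linSubst, eval_dualDet]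

theorem eval_polarPoly_dualMap [CharZero K] {Y : Matrix (Fin (n + 1)) (Fin (n + 1)) K}
    (hY : Y.IsSymm) : eval (E.dualMap Y) E.polarPoly = (lowerBlock Y).det := by
  rw [eval_polarPoly, symMatrix_halfOff_lowProj E hY]

theorem isHomogeneous_polarPoly : E.polarPoly.IsHomogeneous n :=
  isHomogeneous_aeval_linSubst _ isHomogeneous_dualDet

theorem sum_gradient_polarPoly (y u : ι → K) : ∑ i, gradient E.polarPoly y i * u i =
    ((symMatrix (halfOff K n (E.lowProj y))).adjugate *
      symMatrix (halfOff K n (E.lowProj u))).trace := by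
  rw [polarPoly, sum_gradient_aeval_linSubst, dualDet, sum_gradient_aeval_linSubst,
    sum_gradient_symDet]

theorem card_add_one (E : CornerChart K n ι) : Fintype.card ι + 1 = (n + 2).choose 2 := by
  have h1 := LinearMap.finrank_range_of_inj E.toLin_injective
  have h2 : LinearMap.range E.toLin =
      LinearMap.ker (LinearMap.proj s(0, 0) : (Sym2 (Fin (n + 1)) → K) →ₗ[K] K) := by
    ext y
    rw [LinearMap.mem_ker, LinearMap.proj_apply]
    constructor
    · rintro ⟨x, rfl⟩
      exact E.toLin_corner x
    · exact fun h => ⟨_, E.toLin_inv_of_corner h⟩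
  have h3 := LinearMap.finrank_range_add_finrank_ker
    (LinearMap.proj s(0, 0) : (Sym2 (Fin (n + 1)) → K) →ₗ[K] K)
  rw [← h2, h1, LinearMap.range_eq_top.2 (LinearMap.proj_surjective _), finrank_top,
    Module.finrank_self, Module.finrank_fintype_fun_eq_card, Module.finrank_fintype_fun_eq_card,
    Sym2.card, Fintype.card_fin] at h3
  change 1 + Fintype.card ι = (n + 2).choose 2 at h3
  omega

/-- What remains of a class with zero lower block is its border of length `n`; numerically, `C(n+2,
2) - 1 - C(n+1, 2) = n`. -/
theorem finrank_ker_lowProj [CharZero K] :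
    Module.finrank K (LinearMap.ker E.lowProj) = n := by
  have h1 := LinearMap.finrank_range_add_finrank_ker E.lowProj
  rw [LinearMap.range_eq_top.2 E.lowProj_surjective, finrank_top,
    Module.finrank_fintype_fun_eq_card, Module.finrank_fintype_fun_eq_card,
    Sym2.card, Fintype.card_fin] at h1
  have h2 := E.card_add_one
  have h3 : (n + 2).choose 2 = (n + 1) + (n + 1).choose 2 := by
    rw [Nat.choose_succ_succ' (n + 1) 1, Nat.choose_one_right]
  omega

end Fintype

end CornerChart

end PolarGeometry

end

noncomputable section

namespace PolarGeometry

open MvPolynomial Matrix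

theorem eq_zero_of_forall_dotProduct_mulVec {K : Type*} [Field K] [CharZero K] {m : Type*}
    [Fintype m] [DecidableEq m] {M : Matrix m m K} (hM : M.IsSymm)
    (h : ∀ u, u ⬝ᵥ M *ᵥ u = 0) : M = 0 := by
  ext i j
  have h1 := h (Pi.single i 1 + Pi.single j 1)
  have h2 := h (Pi.single i 1)
  have h3 := h (Pi.single j 1)
  simp only [mulVec_add, add_dotProduct, dotProduct_add, single_one_dotProduct,
    mulVec_single_one, col_apply] at h1 h2 h3
  have h4 := hM.apply i j
  rw [Matrix.zero_apply]
  rw [h2, h3, h4, zero_add, add_zero, ← two_mul] at h1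
  simpa using h1

theorem trace_vecMulVec_self_mul {K : Type*} [Field K] {m : Type*} [Fintype m] (w : m → K)
    (M : Matrix m m K) : (vecMulVec w w * M).trace = w ⬝ᵥ M *ᵥ w := by
  rw [vecMulVec_mul, trace_vecMulVec, dotProduct_comm, dotProduct_mulVec]

namespace CornerChart

variable {K : Type*} [Field K] {ι : Type*} [Fintype ι] [DecidableEq ι]

/-! ### Irreducibility of the two equations. -/

section Irreducible

/-- Arrow matrices with zero corner lie in the chart, and their determinant is minus the border
polynomial with at least two border entries. -/
theorem irreducible_detPoly [CharZero K] {m : ℕ} (E : CornerChart K (m + 2) ι) :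
    Irreducible E.detPoly := by
  refine irreducible_of_arrowFamily (k := m + 1) (c := 0) (e := 1) E.isHomogeneous_detPoly
    (E.inv ∘ₗ symCoords K (m + 3) ∘ₗ arrowFamily K (m + 2) 0) (Or.inl ⟨rfl, by omega⟩) one_ne_zero
    fun x => ?_
  have h := E.symMatrix_coords (S := arrowFamily K (m + 2) 0 x) (isSymm_arrowMatrix _ _ _)
    (zero_mul _)
  rw [eval_detPoly, one_mul]
  exact congrArg Matrix.det h

/-- The lower block is unconstrained, so it can be a generic arrow matrix including its corner. -/
theorem irreducible_polarPoly [CharZero K] {m : ℕ} (E : CornerChart K (m + 2) ι) :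
    Irreducible E.polarPoly := by
  refine irreducible_of_arrowFamily (k := m) (c := 1) (e := 1) E.isHomogeneous_polarPoly
    (E.dualMap ∘ₗ extendByZero K (m + 2) ∘ₗ arrowFamily K (m + 1) 1) (Or.inr rfl) one_ne_zero
    fun x => ?_
  have h := E.eval_polarPoly_dualMap
    (isSymm_extendByZero (n := m + 2) (M := arrowFamily K (m + 1) 1 x) (isSymm_arrowMatrix _ _ _))
  rw [one_mul]
  exact h

end Irreducible

/-! ### The polar image: equation, vanishing Hessian, cone structure, dimension. -/

section Polar

variable {m : ℕ} (E : CornerChart K (m + 2) ι) (c : K)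

theorem gradient_eq (x : ι → K) : gradient (C c * E.detPoly) x =
    c • E.dualMap (symMatrix (E.toLin x)).adjugate := by
  rw [gradient_C_mul, gradient_detPoly]

/-- The determinant of the lower block of `adj S` is the corner of `adj (adj S)`, a multiple of `S`,
and `S` has zero corner. -/
theorem eval_polarPoly_gradient [CharZero K] (x : ι → K) :
    eval (gradient (C c * E.detPoly) x) E.polarPoly = 0 := by
  rw [gradient_eq, eval_smul_of_isHomogeneous E.isHomogeneous_polarPoly,
    E.eval_polarPoly_dualMap (isSymm_symMatrix _).adjugate, det_lowerBlock,
    adjugate_adjugate _ (by simp), Matrix.smul_apply, symMatrix_apply, E.toLin_corner]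
  simp

theorem eval_aeval_pderiv (F : MvPolynomial ι K) (G : MvPolynomial ι K) (x : ι → K) :
    eval x (aeval (fun i => pderiv i F) G) = eval (gradient F x) G := by
  rw [← aeval_eq_eval, ← AlgHom.comp_apply, comp_aeval, aeval_eq_eval]
  rfl

theorem lowerBlock_swapMatrix :
    lowerBlock (swapMatrix K (0 : Fin (m + 3)) 1) = Matrix.diagonal (Function.update 1 0 0) := by
  ext i j
  rw [lowerBlock, submatrix_apply, swapMatrix_apply]
  refine Fin.cases ?_ (fun i => ?_) i
  · have h : Equiv.swap (0 : Fin (m + 3)) 1 (Fin.succ 0) = 0 := Equiv.swap_apply_right _ _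
    rw [h, if_neg (Fin.succ_ne_zero j).symm, Matrix.diagonal_apply]
    split_ifs <;> simp
  · have h : Equiv.swap (0 : Fin (m + 3)) 1 (Fin.succ (Fin.succ i)) = Fin.succ (Fin.succ i) :=
      Equiv.swap_apply_of_ne_of_ne (Fin.succ_ne_zero _) (by
        rw [← Fin.succ_zero_eq_one]
        exact fun h => Fin.succ_ne_zero i (Fin.succ_injective _ h))
    rw [h, Matrix.diagonal_apply]
    simp only [Fin.succ_inj, ne_eq, Fin.succ_ne_zero, not_false_eq_true, Function.update_of_ne,
      Pi.one_apply]

theorem hessian_eq_zero [CharZero K] (hc : c ≠ 0) : hessian (C c * E.detPoly) = 0 := by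
  refine hessian_eq_zero_of_relation _ E.polarPoly (MvPolynomial.funext fun x => ?_) ?_
  · rw [eval_aeval_pderiv, eval_polarPoly_gradient, map_zero]
  · by_contra hne
    push Not at hne
    -- `W` is an involution with zero corner, so its gradient is the class of a nonzero multiple of
    -- `W`. The lower block of `W` is `diag(0, 1, …, 1)`, of corank one, so `polarPoly` has a
    -- nonzero derivative there; `U` is a direction that detects it.
    let W := swapMatrix K (0 : Fin (m + 3)) 1
    have hW0 : W 0 0 = 0 := by simp [W, swapMatrix_apply]
    have hdet : W.det ≠ 0 := det_ne_zero_of_mul_eq_one (swapMatrix_mul_self _ _)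
    let x := E.coords W
    have hgrad : gradient (C c * E.detPoly) x = E.dualMap ((c * W.det) • W) := by
      rw [gradient_eq, E.symMatrix_coords (isSymm_swapMatrix _ _) hW0,
        adjugate_eq_det_smul (swapMatrix_mul_self _ _), map_smul, map_smul, smul_smul]
    have h1 : ∀ i, gradient E.polarPoly (gradient (C c * E.detPoly) x) i = 0 := fun i => by
      rw [gradient, ← eval_aeval_pderiv, hne i, map_zero]
    let U : Matrix (Fin (m + 3)) (Fin (m + 3)) K :=
      extendByZero K (m + 2) (vecMulVec (Pi.single 0 1) (Pi.single 0 1))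
    have hU : U.IsSymm := isSymm_extendByZero (transpose_vecMulVec _ _)
    have h2 := E.sum_gradient_polarPoly (gradient (C c * E.detPoly) x) (E.dualMap U)
    simp only [h1, zero_mul, Finset.sum_const_zero] at h2
    rw [hgrad, symMatrix_halfOff_lowProj E ((isSymm_swapMatrix _ _).smul _),
      symMatrix_halfOff_lowProj E hU, lowerBlock_extendByZero] at h2
    have h3 : lowerBlock ((c * W.det) • W) = (c * W.det) • lowerBlock W := rfl
    rw [h3, lowerBlock_swapMatrix, adjugate_smul, adjugate_diagonal_update, smul_mul,
      trace_smul, trace_vecMulVec_self_mul] at h2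
    simp only [single_one_dotProduct, mulVec_single_one, col_apply, vecMulVec_apply,
      Pi.single_eq_same, mul_one, smul_eq_mul] at h2
    exact pow_ne_zero _ (mul_ne_zero hc hdet) h2.symm

/-- The points of the image of the polar map. -/
def polarSet (f : MvPolynomial ι K) : Set (ι → K) := {y | ∃ x : ι → K, x ≠ 0 ∧ y = gradient f x}

/-- On `V(polarPoly)`, away from the locus where the zero-corner lift is singular, every point is an
actual value of the polar map up to scalar. Primality of `polarPoly` removes the exceptional locus.
-/
theorem homIdeal_points_gradient [IsAlgClosed K] [CharZero K] (hc : c ≠ 0) :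
    homIdeal (points (polarSet (C c * E.detPoly))) = Ideal.span {E.polarPoly} := by
  have hprime : Prime E.polarPoly := E.irreducible_polarPoly.prime
  apply le_antisymm
  · intro F hF
    rw [Ideal.mem_span_singleton]
    -- `h` cuts out the exceptional locus: the classes whose representative with zero corner is
    -- singular.
    let h : MvPolynomial ι K := aeval (linSubst E.dualSection) (symDet K (m + 3))
    have hh : ∀ y, eval y h = (symMatrix (E.dualSection y)).det := fun y => by
      rw [eval_aeval_linSubst, eval_symDet]
    have hmem : F * h ∈ vanishingIdeal K (zeroLocus K (Ideal.span {E.polarPoly})) := by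
      rw [mem_vanishingIdeal_iff]
      intro y hy
      rw [zeroLocus_span] at hy
      have hy0 : eval y E.polarPoly = 0 := by simpa [aeval_eq_eval] using hy
      rw [aeval_eq_eval]
      by_cases hz : eval y h = 0
      · rw [map_mul, hz, mul_zero]
      · rw [map_mul]
        refine mul_eq_zero_of_left (mem_homIdeal.1 hF y ?_) _
        rw [hh] at hz
        set Y := symMatrix (E.dualSection y) with hY
        have hYs : Y.IsSymm := isSymm_symMatrix _
        have hyY : E.dualMap Y = y := E.dualMap_dualSection y
        have hcorner : Y.adjugate 0 0 = 0 := by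
          rw [← det_lowerBlock, ← E.eval_polarPoly_dualMap hYs, hyY, hy0]
        -- The preimage of `y` is `adj Y`: its corner is the determinant of the lower block of `Y`,
        -- which is zero, and its adjugate is `det(Y)^(m+1) Y`, the exponent being the size `m + 3`
        -- minus two.
        have hgrad : gradient (C c * E.detPoly) (E.coords Y.adjugate) =
            (c * Y.det ^ (m + 1)) • y := by
          rw [gradient_eq, E.symMatrix_coords hYs.adjugate hcorner,
            adjugate_adjugate _ (by simp), map_smul, hyY, smul_smul]
          simp
        have hne : c * Y.det ^ (m + 1) ≠ 0 := mul_ne_zero hc (pow_ne_zero _ hz)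
        have hy1 : y ≠ 0 := by
          rintro rfl
          rw [hY, map_zero] at hz
          exact hz (Matrix.det_zero)
        refine mem_affineCone_points.2 ⟨hy1, _, ⟨E.coords Y.adjugate, ?_, rfl⟩,
          (c * Y.det ^ (m + 1))⁻¹, ?_⟩
        · intro h0
          rw [h0, gradient_eq, map_zero] at hgrad
          have h1 : (symMatrix (0 : Sym2 (Fin (m + 2 + 1)) → K)).adjugate = 0 := adjugate_zero
          rw [h1, map_zero, smul_zero] at hgrad
          exact smul_ne_zero hne hy1 hgrad.symm
        · rw [hgrad, smul_smul, inv_mul_cancel₀ hne, one_smul]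
    have hP : (Ideal.span {E.polarPoly}).IsPrime :=
      (Ideal.span_singleton_prime hprime.ne_zero).2 hprime
    -- By the Nullstellensatz `polarPoly` divides `F * h`. It does not divide `h`, because at the
    -- class of `W` it vanishes while `h` takes the value `det W ≠ 0`.
    rw [MvPolynomial.IsPrime.vanishingIdeal_zeroLocus, Ideal.mem_span_singleton] at hmem
    refine (hprime.dvd_or_dvd hmem).resolve_right fun hdvd => ?_
    let W := swapMatrix K (0 : Fin (m + 3)) 1
    have hWs : W.IsSymm := isSymm_swapMatrix _ _
    have hW0 : W 0 0 = 0 := by simp [W, swapMatrix_apply]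
    have h1 : eval (E.dualMap W) E.polarPoly = 0 := by
      rw [E.eval_polarPoly_dualMap hWs, lowerBlock_swapMatrix, det_diagonal,
        Finset.prod_eq_zero (Finset.mem_univ 0) (by simp)]
    obtain ⟨k, hk⟩ := hdvd
    have h2 := hh (E.dualMap W)
    rw [hk, map_mul, h1, zero_mul, E.dualSection_dualMap hWs hW0] at h2
    exact det_ne_zero_of_mul_eq_one (swapMatrix_mul_self _ _) h2.symm
  · rw [Ideal.span_singleton_le_iff_mem, mem_homIdeal]
    intro v hv
    obtain ⟨_, _, ⟨x, _, rfl⟩, a, rfl⟩ := mem_affineCone_points.1 hv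
    rw [eval_smul_of_isHomogeneous E.isHomogeneous_polarPoly, eval_polarPoly_gradient, mul_zero]

theorem homIdeal_polarImage [IsAlgClosed K] [CharZero K] (hc : c ≠ 0) :
    homIdeal (polarImage (C c * E.detPoly)) = Ideal.span {E.polarPoly} := by
  rw [polarImage, homIdeal_zariskiClosure]
  exact E.homIdeal_points_gradient c hc

theorem polarImage_eq [IsAlgClosed K] [CharZero K] (hc : c ≠ 0) :
    polarImage (C c * E.detPoly) = hypersurface E.polarPoly := by
  ext x
  rw [polarImage, mem_zariskiClosure]
  change (∀ F ∈ homIdeal (points (polarSet _)), _) ↔ _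
  rw [E.homIdeal_points_gradient c hc]
  constructor
  · exact fun h => h _ (Ideal.mem_span_singleton_self _)
  · intro h F hF
    obtain ⟨k, rfl⟩ := Ideal.mem_span_singleton.1 hF
    rw [map_mul, show eval x.rep E.polarPoly = 0 from h, zero_mul]

/-- The equation is the pullback by `lowProj` of the equation of the dual Veronese. Points with zero
block lie on both sides, as the zero matrix is singular. -/
theorem hypersurface_polarPoly_eq_coneOver [IsAlgClosed K] [CharZero K] :
    hypersurface E.polarPoly = coneOver E.lowProj (dualVariety (veronese K (m + 2))) := by
  rw [dualVariety_veronese]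
  ext x
  change eval x.rep E.polarPoly = 0 ↔
    ∀ h : E.lowProj x.rep ≠ 0, Projectivization.mk K _ h ∈ hypersurface (dualDet K (m + 2))
  rw [polarPoly, eval_aeval_linSubst]
  by_cases h : E.lowProj x.rep = 0
  · rw [h, eval_dualDet, map_zero]
    simp only [ne_eq, not_true_eq_false, IsEmpty.forall_iff, iff_true]
    exact Matrix.det_zero
  · simp only [ne_eq, h, not_false_eq_true, forall_true_left]
    rw [mk_mem_hypersurface isHomogeneous_dualDet]

theorem halfOff_injective {k : ℕ} [CharZero K] : Function.Injective (halfOff K k) := by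
  rw [injective_iff_map_eq_zero]
  intro z hz
  ext s
  have h := congrFun hz s
  simp only [halfOff, LinearMap.coe_mk, AddHom.coe_mk, Pi.zero_apply] at h
  split_ifs at h
  · exact h
  · simpa using h

/-- At a corank one block with kernel `u`, the derivative of the equation towards a vertex point
with block `M` is a nonzero multiple of `uᵗMu`, and it vanishes along a line in the hypersurface.
Letting `u` vary gives `M = 0`. -/
theorem vertex_hypersurface_polarPoly [IsAlgClosed K] [CharZero K] :
    vertex (hypersurface E.polarPoly) = linearSubspace (LinearMap.ker E.lowProj) := by
  have hhom := E.isHomogeneous_polarPoly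
  ext x
  change _ ↔ E.lowProj x.rep = 0
  constructor
  · rintro ⟨-, hx⟩
    set M := symMatrix (halfOff K (m + 2) (E.lowProj x.rep)) with hM
    suffices h : M = 0 by
      have h1 : halfOff K (m + 2) (E.lowProj x.rep) = 0 := symMatrix_injective (hM.symm.trans h)
      exact halfOff_injective (h1.trans (map_zero _).symm)
    refine eq_zero_of_forall_dotProduct_mulVec (isSymm_symMatrix _) fun u => ?_
    by_cases hu : u = 0
    · rw [hu, zero_dotProduct]
    obtain ⟨N, hN, hdet, -, a, ha, hadj⟩ := exists_isSymm_adjugate hu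
    set y := E.dualMap (extendByZero K (m + 2) N) with hy
    have hyN : symMatrix (halfOff K (m + 2) (E.lowProj y)) = N := by
      rw [hy, symMatrix_halfOff_lowProj E (isSymm_extendByZero hN), lowerBlock_extendByZero]
    have hy0 : y ≠ 0 := by
      intro h0
      rw [h0, map_zero, map_zero] at hyN
      have hN0 : N = 0 := hyN.symm
      rw [hN0, adjugate_zero] at hadj
      exact smul_ne_zero ha (vecMulVec_ne_zero hu hu) hadj.symm
    have hyX : Projectivization.mk K y hy0 ∈ hypersurface E.polarPoly := by
      rw [mk_mem_hypersurface hhom, eval_polarPoly, hyN, hdet]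
    obtain ⟨t, ht, hrep⟩ := exists_rep_mk_eq_smul y hy0
    have hline : ∀ s : K, eval (y + s • x.rep) E.polarPoly = 0 := by
      intro s
      by_cases h0 : y + s • x.rep = 0
      · rw [h0, eval_polarPoly, map_zero, map_zero]
        exact Matrix.det_zero
      · rw [← mk_mem_hypersurface hhom h0]
        refine hx _ hyX ⟨_, ⟨s, t⁻¹, ?_⟩, h0, rfl⟩
        rw [hrep, smul_smul, inv_mul_cancel₀ ht, one_smul, add_comm]
    have h1 := sum_gradient_eq_zero_of_line _ _ _ hline
    rw [sum_gradient_polarPoly, hyN, hadj, smul_mul, trace_smul, trace_vecMulVec_self_mul] at h1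
    simpa [ha] using h1
  · intro hx
    have hev : ∀ a b : K, ∀ y : ι → K, eval y E.polarPoly = 0 →
        eval (a • x.rep + b • y) E.polarPoly = 0 := by
      intro a b y hy
      have h1 : eval (b • y) E.polarPoly = 0 := by
        rw [eval_smul_of_isHomogeneous hhom, hy, mul_zero]
      rw [eval_polarPoly] at h1 ⊢
      rwa [map_add, map_smul, hx, smul_zero, zero_add]
    have h0 : eval (0 : ι → K) E.polarPoly = 0 := by
      rw [eval_polarPoly, map_zero, map_zero]
      exact Matrix.det_zero
    refine ⟨?_, ?_⟩
    · have := hev 1 0 0 h0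
      rwa [smul_zero, add_zero, one_smul] at this
    · rintro y hy _ ⟨_, ⟨a, b, rfl⟩, hv, rfl⟩
      rw [mk_mem_hypersurface hhom]
      exact hev a b _ hy

/-- With `d + 2` homogeneous coordinates the ambient projective space has dimension `d + 1`, and the
polar image is a hypersurface in it. -/
theorem hasProjDim_polarImage [IsAlgClosed K] [CharZero K] (hc : c ≠ 0) {d : ℕ}
    (hd : Fintype.card ι = d + 2) : HasProjDim (polarImage (C c * E.detPoly)) d := by
  rw [HasProjDim, homIdeal_polarImage E c hc]
  refine ringKrullDim_quotient_span_singleton _ E.irreducible_polarPoly.ne_zero ?_ hd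
  rw [eval_polarPoly, map_zero, map_zero]
  exact Matrix.det_zero

end Polar

end CornerChart

end PolarGeometry

end

noncomputable section

namespace PolarGeometry

open MvPolynomial Matrix

/-! ### Quadratic forms of symmetric matrices. -/

section QuadraticForms

variable {K : Type*} [Field K] {k : ℕ}

/-- The quadratic form of a symmetric matrix. -/
def quadPoly (u : Sym2 (Fin k) → K) : MvPolynomial (Fin k) K :=
  ∑ s, C ((if s.IsDiag then 1 else 2) * u s) * veronesePoly K k s

theorem eval_quadPoly (u : Sym2 (Fin k) → K) (w : Fin k → K) :
    eval w (quadPoly u) = (vecMulVec w w * symMatrix u).trace := by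
  rw [trace_mul_symMatrix]
  have h := sum_sum_sym2 fun s => u s * eval w (veronesePoly K k s)
  simp only [veronesePoly_mk, map_mul, eval_X] at h
  simp only [quadPoly, map_sum, map_mul, eval_C, vecMulVec_apply]
  calc _ = ∑ s : Sym2 (Fin k), (if s.IsDiag then 1 else 2) *
        (u s * eval w (veronesePoly K k s)) := Finset.sum_congr rfl fun s _ => by ring
    _ = _ := by
      rw [← h]
      exact Finset.sum_congr rfl fun i _ => Finset.sum_congr rfl fun j _ => by ring

theorem quadPoly_single (i j : Fin k) : quadPoly (Pi.single s(i, j) (1 : K)) =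
    C (if i = j then 1 else 2) * (X i * X j) := by
  rw [quadPoly, Finset.sum_eq_single s(i, j)]
  · simp [veronesePoly_mk]
  · intro s _ hs
    simp [hs]
  · simp

end QuadraticForms

namespace CornerChart

variable {K : Type*} [Field K] {ι : Type*} [Fintype ι] [DecidableEq ι]

/-! ### The dual variety as a projected Veronese variety, and its dimension. -/

section Dual

variable {m : ℕ} (E : CornerChart K (m + 2) ι)

/-- The images of the symmetric matrices of rank one. -/
def rankOneSet : Set (ι → K) := {y | ∃ w : Fin (m + 3) → K, w ≠ 0 ∧ y = E.dualMap (vecMulVec w w)}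

theorem dualMap_vecMulVec_smul (t : K) (w : Fin (m + 3) → K) :
    E.dualMap (vecMulVec (t • w) (t • w)) = t ^ 2 • E.dualMap (vecMulVec w w) := by
  rw [smul_vecMulVec, vecMulVec_smul, smul_smul, ← sq, map_smul]

/-- This is the centre of the projection; `points` discards the resulting zero vector. -/
theorem dualMap_corner : E.dualMap (vecMulVec (Pi.single 0 1) (Pi.single 0 1)) = 0 := by
  ext i
  change Matrix.trace (vecMulVec (Pi.single 0 1) (Pi.single 0 1) *
    symMatrix (E.toLin (Pi.single i 1))) = 0
  rw [trace_vecMulVec_self_mul, single_one_dotProduct, mulVec_single_one, col_apply,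
    symMatrix_apply, toLin_corner]

/-- Singular symmetric matrices have adjugate `wwᵗ`, and each `wwᵗ` other than the centre is, up to
scalar, the adjugate of a singular matrix with zero corner. -/
theorem points_gauss_image [IsAlgClosed K] [CharZero K] {c : K} (hc : c ≠ 0) :
    points {y | ∃ x : ι → K, x ≠ 0 ∧ eval x (C c * E.detPoly) = 0 ∧
      y = gradient (C c * E.detPoly) x} = points E.rankOneSet := by
  apply Set.Subset.antisymm <;> apply points_subset_points
  · rintro _ ⟨x, hx, hx0, rfl⟩ hne
    rw [map_mul, eval_C, eval_detPoly] at hx0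
    obtain ⟨w, hw⟩ := exists_adjugate_eq_vecMulVec (isSymm_symMatrix (E.toLin x))
      ((mul_eq_zero.1 hx0).resolve_left hc)
    rw [gradient_eq, hw] at hne ⊢
    refine ⟨_, ⟨w, ?_, rfl⟩, c, rfl⟩
    rintro rfl
    simp at hne
  · rintro _ ⟨w, hw, rfl⟩ hne
    have hli : LinearIndependent K ![Pi.single 0 1, w] := by
      rw [LinearIndependent.pair_iff]
      intro s t hst
      have ht : t = 0 := by
        by_contra ht
        have hw' : w = (-(s / t)) • Pi.single 0 1 := by
          have h1 : w = t⁻¹ • (t • w) := by rw [smul_smul, inv_mul_cancel₀ ht, one_smul]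
          rw [h1, eq_neg_of_add_eq_zero_right hst, ← neg_smul, smul_smul]
          congr 1
          ring
        rw [hw', dualMap_vecMulVec_smul, dualMap_corner, smul_zero] at hne
        exact hne rfl
      refine ⟨?_, ht⟩
      have := congrFun hst 0
      simpa [ht] using this
    obtain ⟨S, hS, hS0, hdet, a, ha, hadj⟩ := exists_isSymm_adjugate_of_apply_zero hli
    have hx := E.symMatrix_coords hS hS0
    have hgrad : gradient (C c * E.detPoly) (E.coords S) =
        (c * a) • E.dualMap (vecMulVec w w) := by
      rw [gradient_eq, hx, hadj, map_smul, smul_smul]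
    refine ⟨_, ⟨E.coords S, ?_, ?_, rfl⟩, (c * a)⁻¹, ?_⟩
    · intro h0
      rw [h0, map_zero] at hx
      have hS00 : S = 0 := hx.symm
      rw [hS00, adjugate_zero] at hadj
      exact smul_ne_zero ha (vecMulVec_ne_zero hw hw) hadj.symm
    · rw [map_mul, eval_detPoly, hx, hdet, mul_zero]
    · rw [hgrad, smul_smul, inv_mul_cancel₀ (mul_ne_zero hc ha), one_smul]

theorem dualOfHypersurface_eq [IsAlgClosed K] [CharZero K] {c : K} (hc : c ≠ 0) :
    dualOfHypersurface (C c * E.detPoly) = zariskiClosure (points E.rankOneSet) := by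
  rw [dualOfHypersurface, E.points_gauss_image hc]

/-- The parametrization of the set of symmetric matrices of rank one. -/
def rankOneHom : MvPolynomial ι K →ₐ[K] MvPolynomial (Fin (m + 3)) K :=
  aeval fun i => quadPoly (E.toLin (Pi.single i 1))

theorem eval_rankOneHom (w : Fin (m + 3) → K) (F : MvPolynomial ι K) :
    eval w (E.rankOneHom F) = eval (E.dualMap (vecMulVec w w)) F := by
  rw [rankOneHom, ← aeval_eq_eval, ← AlgHom.comp_apply, comp_aeval, aeval_eq_eval]
  congr 2
  ext i
  exact eval_quadPoly _ _

theorem rankOneHom_linear [Infinite K] (x : ι → K) :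
    E.rankOneHom (∑ i, C (x i) * X i) = quadPoly (E.toLin x) := by
  refine MvPolynomial.funext fun w => ?_
  rw [eval_rankOneHom, eval_quadPoly, ← sum_dualMap]
  simp [mul_comm]

/-- The ideal of a parametrized set is the kernel of the substitution. Scalars are absorbed by
square roots, since `dualMap (wwᵗ)` is quadratic in `w`. -/
theorem homIdeal_points_rankOneSet [IsAlgClosed K] [CharZero K] :
    homIdeal (points E.rankOneSet) = RingHom.ker E.rankOneHom := by
  ext F
  rw [mem_homIdeal, RingHom.mem_ker]
  constructor
  · intro h
    have h11 : E.toLin (E.inv (Pi.single s(1, 1) 1)) = Pi.single s(1, 1) 1 :=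
      E.toLin_inv_of_corner (by simp)
    have hlin := E.rankOneHom_linear (E.inv (Pi.single s(1, 1) 1))
    rw [h11, quadPoly_single, if_pos rfl, C_1, one_mul] at hlin
    -- `X 1 ^ 2` is the image of a linear form, so it vanishes at every `w` sent to the zero vector,
    -- where membership in the ideal gives no information.
    refine mul_left_cancel₀ (mul_ne_zero (X_ne_zero (1 : Fin (m + 3))) (X_ne_zero 1))
      (MvPolynomial.funext fun w => ?_)
    rw [mul_zero, map_zero, map_mul, ← hlin, eval_rankOneHom, eval_rankOneHom]
    by_cases h0 : E.dualMap (vecMulVec w w) = 0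
    · rw [h0]
      simp
    · rw [h _ (mem_affineCone_points.2 ⟨h0, _, ⟨w, ?_, rfl⟩, 1, (one_smul _ _).symm⟩), mul_zero]
      rintro rfl
      simp at h0
  · intro h v hv
    obtain ⟨-, _, ⟨w, hw, rfl⟩, a, rfl⟩ := mem_affineCone_points.1 hv
    obtain ⟨t, rfl⟩ := IsAlgClosed.exists_pow_nat_eq a (n := 2) (by norm_num)
    rw [← dualMap_vecMulVec_smul, ← eval_rankOneHom, h, map_zero]

/-- The coordinate ring embeds in a polynomial ring in `m + 3` variables, which bounds its
dimension. Contracting the flag of coordinate primes gives a chain of that length. -/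
theorem hasProjDim_rankOneSet [IsAlgClosed K] [CharZero K] :
    HasProjDim (zariskiClosure (points E.rankOneSet)) (m + 2) := by
  rw [HasProjDim, homIdeal_zariskiClosure, homIdeal_points_rankOneSet]
  let f := Ideal.kerLiftAlg E.rankOneHom
  have hf : Function.Injective f := Ideal.kerLiftAlg_injective _
  have : Nontrivial (MvPolynomial ι K ⧸ RingHom.ker E.rankOneHom) :=
    Ideal.Quotient.nontrivial_iff.2 (RingHom.ker_ne_top _)
  refine le_antisymm (ringKrullDim_le_of_injective f hf) ?_
  refine natCast_le_ringKrullDim_of_strictMono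
    (fun j => ⟨(coordIdeal K (m + 3) j).comap f, inferInstance⟩)
    (Fin.strictMono_iff_lt_succ.2 fun i => ?_)
  refine lt_of_le_not_ge (Ideal.comap_mono (coordIdeal_mono _ (by simp))) fun h => ?_
  -- The product `wᵢwⱼ` separates consecutive contracted primes. One takes `j = i`, except for `i =
  -- 0`: there `w₀²` is the missing corner and `w₀w₁` replaces it.
  obtain ⟨j, hij, hj0⟩ : ∃ j : Fin (m + 3), i ≤ j ∧ s(i, j) ≠ s(0, 0) := by
    by_cases hi : i = 0
    · exact ⟨1, by simp [hi], by simp⟩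
    · exact ⟨i, le_rfl, by simpa using hi⟩
  have hE : E.toLin (E.inv (Pi.single s(i, j) 1)) = Pi.single s(i, j) 1 :=
    E.toLin_inv_of_corner (by rw [Pi.single_eq_of_ne hj0.symm])
  have hlin := E.rankOneHom_linear (E.inv (Pi.single s(i, j) 1))
  rw [hE, quadPoly_single] at hlin
  have h1 : Ideal.Quotient.mk (RingHom.ker E.rankOneHom)
      (∑ l, C (E.inv (Pi.single s(i, j) 1) l) * X l) ∈
      (coordIdeal K (m + 3) (i.succ : ℕ)).comap f := by
    rw [Ideal.mem_comap]
    change E.rankOneHom _ ∈ _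
    rw [hlin]
    exact Ideal.mul_mem_left _ _ (Ideal.mul_mem_right _ _ (X_mem_coordIdeal.2 (by simp)))
  have h2 := h h1
  rw [Ideal.mem_comap] at h2
  change E.rankOneHom _ ∈ coordIdeal K (m + 3) (i : ℕ) at h2
  have hP := coordIdeal_isPrime (K := K) (m + 3) i
  rw [hlin, hP.mul_mem_iff_mem_or_mem, hP.mul_mem_iff_mem_or_mem,
    X_mem_coordIdeal, X_mem_coordIdeal] at h2
  rcases h2 with h2 | h2 | h2
  · refine (coordIdeal_isPrime (K := K) (m + 3) i).ne_top (Ideal.eq_top_of_isUnit_mem _ h2 ?_)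
    refine IsUnit.map C (isUnit_iff_ne_zero.2 ?_)
    split_ifs <;> norm_num
  · exact lt_irrefl _ h2
  · exact absurd h2 (not_lt.2 hij)

end Dual

end CornerChart

end PolarGeometry

end

noncomputable section

namespace PolarGeometry

open MvPolynomial Matrix

/-! ### Congruence, and restriction to a linear subspace. -/

section Congruence

variable {K : Type*} [Field K] {m : ℕ}

/-- The action of a matrix on symmetric matrices by congruence. -/
def congrLin (P : Matrix (Fin m) (Fin m) K) : (Sym2 (Fin m) → K) →ₗ[K] (Sym2 (Fin m) → K) where
  toFun y := symCoords K m (Pᵀ * symMatrix y * P)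
  map_add' y z := by rw [symMatrix_add, mul_add, add_mul, map_add]
  map_smul' c y := by rw [symMatrix_smul, Matrix.mul_smul, Matrix.smul_mul, map_smul, RingHom.id_apply]

theorem symMatrix_congrLin [CharZero K] (P : Matrix (Fin m) (Fin m) K) (y : Sym2 (Fin m) → K) :
    symMatrix (congrLin P y) = Pᵀ * symMatrix y * P :=
  symMatrix_symCoords (isSymm_congr (isSymm_symMatrix y) P)

theorem congrLin_congrLin [CharZero K] {P Q : Matrix (Fin m) (Fin m) K} (h : P * Q = 1)
    (y : Sym2 (Fin m) → K) : congrLin Q (congrLin P y) = y := by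
  apply symMatrix_injective
  rw [symMatrix_congrLin, symMatrix_congrLin]
  calc Qᵀ * (Pᵀ * symMatrix y * P) * Q = (P * Q)ᵀ * symMatrix y * (P * Q) := by
        rw [transpose_mul]
        simp only [Matrix.mul_assoc]
    _ = symMatrix y := by rw [h, transpose_one, Matrix.one_mul, Matrix.mul_one]

theorem mem_perp {p : ℙ K (Sym2 (Fin m) → K)} {v : Fin m → K}
    (hv : symMatrix p.rep = vecMulVec v v) {y : Sym2 (Fin m) → K} :
    y ∈ perp p ↔ v ⬝ᵥ symMatrix y *ᵥ v = 0 := by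
  rw [← trace_vecMulVec_self_mul, ← hv]
  rfl

/-- Via `mem_perp`, this shows that congruence by `P` takes the hyperplane of `vvᵗ`, with `v = Pe₀`,
to the matrices with zero corner. -/
theorem congrLin_corner [CharZero K] (P : Matrix (Fin (m + 1)) (Fin (m + 1)) K)
    (y : Sym2 (Fin (m + 1)) → K) : congrLin P y s(0, 0) =
    P *ᵥ Pi.single 0 1 ⬝ᵥ symMatrix y *ᵥ (P *ᵥ Pi.single 0 1) := by
  have h : symMatrix (congrLin P y) 0 0 =
      Pi.single 0 1 ⬝ᵥ symMatrix (congrLin P y) *ᵥ Pi.single 0 1 := by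
    rw [single_one_dotProduct, mulVec_single_one, col_apply]
  rw [← symMatrix_apply (congrLin P y), h, symMatrix_congrLin, ← mulVec_mulVec, ← mulVec_mulVec,
    dotProduct_mulVec _ Pᵀ, vecMul_transpose]

theorem embedding_single {ι κ : Type*} [Fintype ι] [DecidableEq ι] {H : Submodule K (κ → K)}
    (b : Module.Basis ι K H) (i : ι) : embedding b (Pi.single i 1) = b i := by
  simp [embedding]

theorem restrict_eq {ι κ : Type*} [Fintype ι] [DecidableEq ι] {H : Submodule K (κ → K)}
    (b : Module.Basis ι K H) (g : MvPolynomial κ K) :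
    restrict b g = aeval (linSubst (embedding b)) g := by
  have h : (fun s => ∑ i, C ((b i : κ → K) s) * X i) = linSubst (embedding b) := by
    ext1 s
    simp only [linSubst, embedding_single]
  rw [restrict, h]

end Congruence

/-! ### The hyperplane `p^⊥` in normal form. -/

section Perp

variable {K : Type*} [Field K] [CharZero K] {n : ℕ} {p : ℙ K (Sym2 (Fin (n + 1)) → K)}
  {ι : Type*} [Fintype ι]

/-- The coordinates on `p^⊥`, after a change of basis which moves `p` to a unit matrix. -/
def perpChart (b : Module.Basis ι K (perp p)) {P Q : Matrix (Fin (n + 1)) (Fin (n + 1)) K}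
    (hPQ : P * Q = 1) (hQP : Q * P = 1)
    (hp : symMatrix p.rep = vecMulVec (P *ᵥ Pi.single 0 1) (P *ᵥ Pi.single 0 1)) :
    CornerChart K n ι where
  toLin := congrLin P ∘ₗ embedding b
  inv := b.equivFun.toLinearMap ∘ₗ LinearMap.codRestrict (perp p)
    (congrLin Q ∘ₗ (LinearMap.id - LinearMap.single K (fun _ => K) s(0, 0) ∘ₗ
      LinearMap.proj s(0, 0))) fun y => by
        rw [mem_perp hp, ← congrLin_corner, LinearMap.comp_apply, congrLin_congrLin hQP]
        simp
  inv_toLin x := by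
    rw [LinearMap.comp_apply, LinearEquiv.coe_coe, ← LinearEquiv.eq_symm_apply]
    apply Subtype.ext
    have h : congrLin P (embedding b x) s(0, 0) = 0 := by
      rw [congrLin_corner, ← mem_perp hp]
      exact (b.equivFun.symm x).2
    simp only [LinearMap.codRestrict_apply, LinearMap.comp_apply, LinearMap.sub_apply,
      LinearMap.proj_apply, h, map_zero, sub_zero, LinearMap.id_apply, congrLin_congrLin hPQ]
    rfl
  toLin_inv y := by
    simp only [LinearMap.comp_apply, embedding, LinearEquiv.coe_coe, LinearEquiv.symm_apply_apply,
      Submodule.subtype_apply, LinearMap.codRestrict_apply, congrLin_congrLin hQP]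
    rfl

variable [DecidableEq ι] (b : Module.Basis ι K (perp p))
  {P Q : Matrix (Fin (n + 1)) (Fin (n + 1)) K} (hPQ : P * Q = 1) (hQP : Q * P = 1)
  (hp : symMatrix p.rep = vecMulVec (P *ᵥ Pi.single 0 1) (P *ᵥ Pi.single 0 1))


theorem restrict_symDet_eq :
    restrict b (symDet K (n + 1)) = C (Q.det ^ 2) * (perpChart b hPQ hQP hp).detPoly := by
  refine MvPolynomial.funext fun x => ?_
  rw [restrict_eq, eval_aeval_linSubst, eval_symDet, map_mul, eval_C, CornerChart.eval_detPoly]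
  change _ = _ * (symMatrix (congrLin P (embedding b x))).det
  have h : P.det * Q.det = 1 := by rw [← det_mul, hPQ, det_one]
  rw [symMatrix_congrLin, det_mul, det_mul, det_transpose]
  linear_combination (-(symMatrix (embedding b x)).det * (1 + P.det * Q.det)) * h

/-- The dual space transforms by the inverse: `wᵗSw = (Qw)ᵗ(PᵗSP)(Qw)`. -/
theorem projectionFrom_eq {y : Sym2 (Fin (n + 1)) → K} {w : Fin (n + 1) → K}
    (hy : symMatrix y = vecMulVec w w) : projectionFrom b y =
    (perpChart b hPQ hQP hp).dualMap (vecMulVec (Q *ᵥ w) (Q *ᵥ w)) := by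
  ext i
  change (symMatrix y * symMatrix (b i : Sym2 (Fin (n + 1)) → K)).trace =
    (_ * symMatrix (congrLin P (embedding b (Pi.single i 1)))).trace
  rw [embedding_single, hy, trace_vecMulVec_self_mul, trace_vecMulVec_self_mul,
    symMatrix_congrLin, ← mulVec_mulVec, mulVec_mulVec _ P, hPQ, one_mulVec, ← mulVec_mulVec,
    dotProduct_mulVec _ Pᵀ, vecMul_transpose, mulVec_mulVec, hPQ, one_mulVec]

end Perp

/-! ### The determinantal hypersurface, its sections and tangent hyperplanes. -/

section Section

variable {K : Type*} [Field K]

theorem rank_le_iff_det_eq_zero {n : ℕ} {S : Matrix (Fin (n + 1)) (Fin (n + 1)) K} :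
    S.rank ≤ n ↔ S.det = 0 := by
  constructor
  · intro h
    by_contra h0
    have h1 := rank_of_isUnit S ((isUnit_iff_isUnit_det S).2 (isUnit_iff_ne_zero.2 h0))
    rw [Fintype.card_fin] at h1
    omega
  · intro h
    obtain ⟨v, hv, hSv⟩ := exists_mulVec_eq_zero_iff.2 h
    have h1 := S.mulVecLin.finrank_range_add_finrank_ker
    have h2 : 0 < Module.finrank K (LinearMap.ker S.mulVecLin) :=
      Module.finrank_pos_iff_exists_ne_zero.2 ⟨⟨v, hSv⟩, fun h => hv (congrArg Subtype.val h)⟩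
    rw [Module.finrank_fintype_fun_eq_card, Fintype.card_fin] at h1
    change S.rank + _ = _ at h1
    omega

theorem symRankLocus_eq_hypersurface (K : Type*) [Field K] (n : ℕ) :
    symRankLocus K (n + 1) n = hypersurface (symDet K (n + 1)) := by
  ext x
  change (symMatrix x.rep).rank ≤ n ↔ eval x.rep (symDet K (n + 1)) = 0
  rw [rank_le_iff_det_eq_zero, eval_symDet]

theorem linearSection_hypersurface {ι κ : Type*} [Fintype ι] [DecidableEq ι]
    {H : Submodule K (κ → K)} (b : Module.Basis ι K H) {g : MvPolynomial κ K} {d : ℕ}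
    (hg : g.IsHomogeneous d) :
    linearSection b (hypersurface g) = hypersurface (restrict b g) := by
  ext x
  change Projectivization.map _ _ x ∈ hypersurface g ↔ eval x.rep _ = 0
  rw [restrict_eq, eval_aeval_linSubst]
  conv_lhs => rw [← x.mk_rep]
  rw [Projectivization.map_mk, mk_mem_hypersurface hg]

theorem mem_tangentHyperplane {ι : Type*} [Fintype ι] {F : MvPolynomial ι K} {x u : ι → K} :
    u ∈ tangentHyperplane F x ↔ ∑ i, gradient F x i * u i = 0 := by
  simp [tangentHyperplane]

/-- For `p = [vvᵗ]`, take for `q` a corank one matrix with kernel `v`: the gradient of `det` there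
is the adjugate, a nonzero multiple of `vvᵗ`. -/
theorem exists_tangentHyperplane_eq_perp [CharZero K] {n : ℕ} {p : ℙ K (Sym2 (Fin (n + 3)) → K)}
    {v : Fin (n + 3) → K} (hv : v ≠ 0) (hp : symMatrix p.rep = vecMulVec v v) :
    ∃ q ∈ symRankLocus K (n + 3) (n + 2) \ symRankLocus K (n + 3) (n + 1),
      tangentHyperplane (symDet K (n + 3)) q.rep = perp p := by
  obtain ⟨S, hS, -, hrank, c, hc, hadj⟩ := exists_isSymm_adjugate hv
  have hS0 : symCoords K (n + 3) S ≠ 0 := fun h => by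
    have h1 := symMatrix_symCoords hS
    rw [h] at h1
    have h2 : S = 0 := h1.symm
    rw [h2, rank_zero] at hrank
    omega
  obtain ⟨a, ha, hrep⟩ := exists_rep_mk_eq_smul _ hS0
  have hq : symMatrix (Projectivization.mk K _ hS0).rep = a • S := by
    rw [hrep, symMatrix_smul, symMatrix_symCoords hS]
  have hr : (symMatrix (Projectivization.mk K _ hS0).rep).rank = n + 2 := by
    rw [hq]
    exact (rank_smul_of_mem_nonZeroDivisors S (mem_nonZeroDivisors_of_ne_zero ha)).trans hrank
  refine ⟨Projectivization.mk K _ hS0, ⟨hr.le, fun h => ?_⟩, ?_⟩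
  · change Matrix.rank _ ≤ n + 1 at h
    omega
  · ext u
    rw [mem_tangentHyperplane, mem_perp hp, sum_gradient_symDet, hq, adjugate_smul, hadj,
      smul_smul, smul_mul, trace_smul, trace_vecMulVec_self_mul, smul_eq_mul,
      mul_eq_zero_iff_left (mul_ne_zero (pow_ne_zero _ ha) hc)]

end Section

end PolarGeometry

end

/-! ### Assembly of the theorem. -/

theorem corollary4p5 {K : Type*} [Field K] [IsAlgClosed K] [CharZero K] (n : ℕ) (hn : 2 ≤ n)
    (p : ℙ K (Sym2 (Fin (n + 1)) → K)) (hp : p ∈ PolarGeometry.veronese K (n + 1))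
    {ι : Type*} [Fintype ι] [DecidableEq ι] (b : Module.Basis ι K (PolarGeometry.perp p))
    (f : MvPolynomial ι K)
    (hf : f = PolarGeometry.restrict b (PolarGeometry.symDet K (n + 1))) :
    -- `p^⊥` is the tangent hyperplane of `S_n` at a point `q` of `S_n \ S_{n-1}`
    (∃ q ∈ PolarGeometry.symRankLocus K (n + 1) n \ PolarGeometry.symRankLocus K (n + 1) (n - 1),
      PolarGeometry.tangentHyperplane (PolarGeometry.symDet K (n + 1)) q.rep =
        PolarGeometry.perp p) ∧
    -- the ambient space `p^⊥` has projective dimension `(n^2 + 3n - 2) / 2`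
    Fintype.card ι = (n ^ 2 + 3 * n - 2) / 2 + 1 ∧
    -- (i) `Q_n = S_n ∩ p^⊥` is the irreducible hypersurface `V(f)`
    (PolarGeometry.linearSection b (PolarGeometry.symRankLocus K (n + 1) n) =
        PolarGeometry.hypersurface f ∧
      Irreducible f ∧ f.IsHomogeneous (n + 1) ∧
      PolarGeometry.hessian f = 0 ∧
      PolarGeometry.dualOfHypersurface f =
        PolarGeometry.projection (PolarGeometry.projectionFrom b)
          (PolarGeometry.veronese K (n + 1))) ∧
    -- (ii) the polar image
    (PolarGeometry.IsHypersurfaceOfDegree (PolarGeometry.polarImage f) n ∧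
      ∃ π : (ι → K) →ₗ[K] (Sym2 (Fin n) → K), Function.Surjective π ∧
        PolarGeometry.polarImage f =
          PolarGeometry.coneOver π (PolarGeometry.dualVariety (PolarGeometry.veronese K n)) ∧
        PolarGeometry.vertex (PolarGeometry.polarImage f) =
          PolarGeometry.linearSubspace (LinearMap.ker π) ∧
        Module.finrank K (LinearMap.ker π) = n) ∧
    -- (iii) the codimension
    PolarGeometry.HasCodim (PolarGeometry.dualOfHypersurface f) (PolarGeometry.polarImage f)
      ((n ^ 2 + n - 4) / 2) := by
  open PolarGeometry MvPolynomial Matrix in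
  obtain ⟨m, rfl⟩ := Nat.exists_eq_add_of_le' hn
  obtain ⟨v, hv, hpv⟩ := exists_of_mem_veronese hp
  obtain ⟨P, Q, hPQ, hQP, rfl⟩ := exists_invertible_of_ne_zero hv
  let E := perpChart b hPQ hQP hpv
  let c : K := Q.det ^ 2
  have hc : c ≠ 0 := pow_ne_zero 2 (det_ne_zero_of_mul_eq_one hPQ)
  have hfE : f = C c * E.detPoly := hf.trans (restrict_symDet_eq b hPQ hQP hpv)
  have hpolar : polarImage f = hypersurface E.polarPoly := by rw [hfE, E.polarImage_eq c hc]
  have hdual : dualOfHypersurface f = zariskiClosure (points E.rankOneSet) := by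
    rw [hfE, E.dualOfHypersurface_eq hc]
  have hcard := E.card_add_one
  rw [Nat.choose_two_right] at hcard
  -- Naming the only quadratic term makes the dimension counts linear.
  obtain ⟨d, hd⟩ : ∃ d, m ^ 2 = d := ⟨_, rfl⟩
  have hcard2 : 2 * Fintype.card ι + 2 = (m + 4) * (m + 3) := by
    have h := Nat.div_mul_cancel (Nat.even_mul_pred_self (m + 4)).two_dvd
    change (m + 4) * (m + 3) / 2 * 2 = (m + 4) * (m + 3) at h
    change _ = (m + 4) * (m + 3) / 2 at hcard
    omega
  have hsq : (m + 4) * (m + 3) = d + 7 * m + 12 := by rw [← hd]; ring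
  have hsq2 : (m + 2) ^ 2 = d + 4 * m + 4 := by rw [← hd]; ring
  refine ⟨exists_tangentHyperplane_eq_perp hv hpv, by omega, ⟨?_, ?_, ?_, ?_, ?_⟩, ⟨?_, ?_⟩, ?_⟩
  · rw [symRankLocus_eq_hypersurface, linearSection_hypersurface b isHomogeneous_symDet, hf]
  · rw [hfE]
    exact (irreducible_isUnit_mul ((isUnit_iff_ne_zero.2 hc).map C)).2 E.irreducible_detPoly
  · rw [hfE]
    exact E.isHomogeneous_detPoly.C_mul c
  · rw [hfE, E.hessian_eq_zero c hc]
  · rw [hdual, projection]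
    congr 1
    -- The normal form replaces `w` by `Qw`, an invertible change of parameter, so both sets of rank
    -- one classes have the same points.
    apply Set.Subset.antisymm <;> apply points_subset_points
    · rintro _ ⟨w, hw, rfl⟩ -
      have hPw : P *ᵥ w ≠ 0 := fun h => hw (by
        rw [← one_mulVec w, ← hQP, ← mulVec_mulVec, h, mulVec_zero])
      obtain ⟨x, hx, t, ht, hxt⟩ := exists_mem_veronese hPw
      refine ⟨_, ⟨x, hx, rfl⟩, (t ^ 2)⁻¹, ?_⟩
      rw [projectionFrom_eq b hPQ hQP hpv hxt, mulVec_smul, mulVec_mulVec, hQP, one_mulVec,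
        E.dualMap_vecMulVec_smul, smul_smul, inv_mul_cancel₀ (pow_ne_zero 2 ht), one_smul]
    · rintro _ ⟨x, hx, rfl⟩ -
      obtain ⟨w, hw, hxw⟩ := exists_of_mem_veronese hx
      refine ⟨_, ⟨Q *ᵥ w, fun h => hw ?_, rfl⟩, 1, ?_⟩
      · rw [← one_mulVec w, ← hPQ, ← mulVec_mulVec, h, mulVec_zero]
      · rw [projectionFrom_eq b hPQ hQP hpv hxw, one_smul]
  · exact ⟨E.polarPoly, E.irreducible_polarPoly.squarefree, E.isHomogeneous_polarPoly, hpolar⟩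
  · refine ⟨E.lowProj, E.lowProj_surjective, ?_, ?_, E.finrank_ker_lowProj⟩
    · rw [hpolar, E.hypersurface_polarPoly_eq_coneOver]
    · rw [hpolar, E.vertex_hypersurface_polarPoly]
  · refine ⟨zariskiClosure_mono (points_subset_points ?_), m + 2, ?_, ?_⟩
    · rintro y ⟨x, hx, -, rfl⟩ -
      exact ⟨_, ⟨x, hx, rfl⟩, 1, (one_smul _ _).symm⟩
    · rw [hdual]
      exact E.hasProjDim_rankOneSet
    · rw [hfE]
      exact E.hasProjDim_polarImage c hc (by omega)
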